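/- Let $\mathscr A$ be an abelian category. A complete hereditary cotorsion pair in $\mathscr A$ is a pair $(\mathcal D,\mathcal E)$ of classes of objects, each the orthogonal of the other with respect to $\mathrm{Ext}^1$, such that every object $X$ admits short exact sequences $0\to X\to E\to D\to 0$ and $0\to E'\to D'\to X\to 0$ with $D,D'\in\mathcal D$, $E,E'\in\mathcal E$, and such that $\mathcal D$ is closed under kernels of epimorphisms between its objects and $\mathcal E$ under cokernels of monomorphisms between its objects. A localization context $(\mathcal D',\mathcal E')\to(\mathcal D,\mathcal E)$ consists of two complete hereditary cotorsion pairs with $\mathcal D'\subseteq\mathcal D$ and $\mathcal D'\cap\mathcal E'=\mathcal D\cap\mathcal E$. An abelian model structure is one whose cofibrations are the monomorphisms with cofibrant cokernel and whose fibrations are the epimorphisms with fibrant kernel; $(\mathcal C,?,\mathcal F)$ denotes such a model structure with cofibrant objects $\mathcal C$ and fibrant objects $\mathcal F$. Let $(\mathcal D'',\mathcal E'')\xrightarrow{\alpha}(\mathcal D',\mathcal E')\xrightarrow{\beta}(\mathcal D,\mathcal E)$ be localization contexts. Then $(\mathcal D'',\mathcal E'')\xrightarrow{\beta\alpha}(\mathcal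 D,\mathcal E)$ is a localization context, and there are unique abelian model structures on $\mathscr A$ of the form $$\mathrm{Loc}(\alpha)=(\mathcal D',?,\mathcal E''),\qquad \mathrm{Loc}(\beta\alpha)=(\mathcal D,?,\mathcal E''),\qquad \mathrm{Loc}(\beta)=(\mathcal D,?,\mathcal E').$$ The identity functors are Quillen adjunctions $\mathrm{Loc}(\alpha)\rightleftarrows\mathrm{Loc}(\beta\alpha)\rightleftarrows\mathrm{Loc}(\beta)$, with left adjoints pointing to the right. The three homotopy categories carry canonical triangulated structures, in which the distinguished triangles are exactly those isomorphic to the triangles induced, via natural connecting morphisms, by the short exact sequences in $\mathscr A$. The derived adjunctions $$\mathbf L\mathrm{id}:\mathrm{Ho}\,\mathrm{Loc}(\alpha)\rightleftarrows\mathrm{Ho}\,\mathrm{Loc}(\beta\alpha):\mathbf R\mathrm{id},\qquad \mathbf L\mathrm{id}:\mathrm{Ho}\,\mathrm{Loc}(\beta\alpha)\rightleftarrows\mathrm{Ho}\,\mathrm{Loc}(\beta):\mathbf R\mathrm{id}$$ exist and form a localization sequence of triangulated categories: all four functors are triangulated; $\mathbf L\mathrm{id}:\mathrm{Ho}\,\mathrm{Loc}(\alpha)\to\mathrm{Ho}\,\mathrm{Loc}(\beta\alpha)$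 and $\mathbf R\mathrm{id}:\mathrm{Ho}\,\mathrm{Loc}(\beta)\to\mathrm{Ho}\,\mathrm{Loc}(\beta\alpha)$ are fully faithful; the kernel of $\mathbf L\mathrm{id}:\mathrm{Ho}\,\mathrm{Loc}(\beta\alpha)\to\mathrm{Ho}\,\mathrm{Loc}(\beta)$ is the essential image of the former, and the kernel of $\mathbf R\mathrm{id}:\mathrm{Ho}\,\mathrm{Loc}(\beta\alpha)\to\mathrm{Ho}\,\mathrm{Loc}(\alpha)$ is the essential image of the latter. -/

import Mathlib

open CategoryTheory CategoryTheory.Limits CategoryTheory.Abelian CategoryTheory.Pretriangulated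
open HomotopicalAlgebra

universe w v u

namespace LocSeq

section CotorsionPairs

variable {A : Type u} [Category.{v} A] [Abelian A]

/-- `(D, E)` is a cotorsion pair: `D` is the left orthogonal of `E` and `E` is the right
orthogonal of `D`, with respect to `Ext¹`. -/
structure IsCotorsionPair [HasExt.{w} A] (D E : ObjectProperty A) : Prop where
  left_iff : ∀ X : A, D X ↔ ∀ Y : A, E Y → Subsingleton (Ext.{w} X Y 1)
  right_iff : ∀ Y : A, E Y ↔ ∀ X : A, D X → Subsingleton (Ext.{w} X Y 1)

/-- Completeness of a pair of classes of objects: every `X` admits short exact sequences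
`0 ⟶ X ⟶ Y ⟶ Z ⟶ 0` and `0 ⟶ Y' ⟶ Z' ⟶ X ⟶ 0` with `Y, Y'` in `E` and `Z, Z'` in `D`. -/
structure IsCompletePair (D E : ObjectProperty A) : Prop where
  enough_injectives : ∀ X : A, ∃ (Y Z : A) (i : X ⟶ Y) (p : Y ⟶ Z) (h : i ≫ p = 0),
    (ShortComplex.mk i p h).ShortExact ∧ E Y ∧ D Z
  enough_projectives : ∀ X : A, ∃ (Y Z : A) (i : Y ⟶ Z) (p : Z ⟶ X) (h : i ≫ p = 0),
    (ShortComplex.mk i p h).ShortExact ∧ E Y ∧ D Z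

/-- `D` is closed under kernels of epimorphisms between its objects, and `E` is closed under
cokernels of monomorphisms between its objects. -/
structure IsHereditaryPair (D E : ObjectProperty A) : Prop where
  resolving : ∀ S : ShortComplex A, S.ShortExact → D S.X₂ → D S.X₃ → D S.X₁
  coresolving : ∀ S : ShortComplex A, S.ShortExact → E S.X₁ → E S.X₂ → E S.X₃

/-- A complete hereditary cotorsion pair. -/
structure IsCHCotorsionPair [HasExt.{w} A] (D E : ObjectProperty A) : Prop where
  cotorsion : IsCotorsionPair.{w} D E
  complete : IsCompletePair D E
  hereditary : IsHereditaryPair D E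

/-- A localization context `(D', E') ⟶ (D, E)`: two complete hereditary cotorsion pairs with the
same core `D' ∩ E' = D ∩ E` and with `D' ⊆ D`. -/
structure IsLocalizationContext [HasExt.{w} A] (D' E' D E : ObjectProperty A) : Prop where
  source : IsCHCotorsionPair.{w} D' E'
  target : IsCHCotorsionPair.{w} D E
  core_eq : D' ⊓ E' = D ⊓ E
  le : D' ≤ D

end CotorsionPairs

section ModelStructures

variable (A : Type u) [Category.{v} A] [Abelian A]

/-- An abelian model structure on the abelian category `A`: a model structure whose cofibrations
are the monomorphisms with cofibrant cokernel and whose fibrations are the epimorphisms with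
fibrant kernel. -/
structure AbelianModelStructure where
  model : ModelCategory A
  cofibrations_iff : ∀ ⦃X Y : A⦄ (f : X ⟶ Y),
    cofibrations A f ↔ Mono f ∧ IsCofibrant (cokernel f)
  fibrations_iff : ∀ ⦃X Y : A⦄ (f : X ⟶ Y),
    fibrations A f ↔ Epi f ∧ IsFibrant (kernel f)

end ModelStructures

namespace AbelianModelStructure

variable {A : Type u} [Category.{v} A] [Abelian A]

/-- The class of cofibrations. -/
def Cof (M : AbelianModelStructure A) : MorphismProperty A :=
  letI := M.model
  cofibrations A

/-- The class of fibrations. -/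
def Fib (M : AbelianModelStructure A) : MorphismProperty A :=
  letI := M.model
  fibrations A

/-- The class of weak equivalences. -/
def W (M : AbelianModelStructure A) : MorphismProperty A :=
  letI := M.model
  weakEquivalences A

/-- The class of cofibrant objects. -/
def cofibrant (M : AbelianModelStructure A) : ObjectProperty A := fun X =>
  letI := M.model
  IsCofibrant X

/-- The class of fibrant objects. -/
def fibrant (M : AbelianModelStructure A) : ObjectProperty A := fun X =>
  letI := M.model
  IsFibrant X

/-- `M` is of the form `(C, ?, F)`: its cofibrant objects are `C`, its fibrant objects are `F`. -/
structure IsTriple (M : AbelianModelStructure A) (C F : ObjectProperty A) : Prop where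
  cofibrant_eq : M.cofibrant = C
  fibrant_eq : M.fibrant = F

/-- The homotopy category: the localization of `A` at the weak equivalences. -/
abbrev Ho (M : AbelianModelStructure A) := M.W.Localization

/-- The localization functor to the homotopy category. -/
abbrev Q (M : AbelianModelStructure A) : A ⥤ M.Ho := M.W.Q

/-- The identity functors form a Quillen adjunction, with left adjoint from `M` to `N`. -/
structure IsIdentityQuillenAdjunction (M N : AbelianModelStructure A) : Prop where
  cof_le : M.Cof ≤ N.Cof
  fib_le : N.Fib ≤ M.Fib

/-- The canonical triangulated structure on the homotopy category: a triangulated structure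
together with connecting morphisms, natural in short exact sequences of `A`, such that the
distinguished triangles are exactly those isomorphic to the triangles
`Q X ⟶ Q Y ⟶ Q Z ⟶ (Q X)⟦1⟧` of the short exact sequences `0 ⟶ X ⟶ Y ⟶ Z ⟶ 0` in `A`.
When every `X` embeds into a weakly trivial object (whose image under `Q` is zero), this pins down
the suspension functor and the distinguished triangles, up to a unique isomorphism compatible with
the connecting morphisms. -/
class CanonicalTriangulation (M : AbelianModelStructure A) where
  preadditive : Preadditive M.Ho
  hasZeroObject : HasZeroObject M.Ho
  hasShift : HasShift M.Ho ℤ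
  additive : ∀ n : ℤ, (shiftFunctor M.Ho n).Additive
  pretriangulated : Pretriangulated M.Ho
  isTriangulated : CategoryTheory.IsTriangulated M.Ho
  δ : ∀ S : ShortComplex A, S.ShortExact → (M.Q.obj S.X₃ ⟶ (M.Q.obj S.X₁)⟦(1 : ℤ)⟧)
  δ_naturality : ∀ (S S' : ShortComplex A) (hS : S.ShortExact) (hS' : S'.ShortExact) (φ : S ⟶ S'),
    δ S hS ≫ (M.Q.map φ.τ₁)⟦(1 : ℤ)⟧' = M.Q.map φ.τ₃ ≫ δ S' hS'
  distinguished_iff : ∀ T : Triangle M.Ho, T ∈ distTriang M.Ho ↔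
    ∃ (S : ShortComplex A) (hS : S.ShortExact),
      Nonempty (T ≅ Triangle.mk (M.Q.map S.f) (M.Q.map S.g) (δ S hS))

section

variable (M : AbelianModelStructure A) [T : M.CanonicalTriangulation]

instance : Preadditive M.Ho := T.preadditive

instance : HasZeroObject M.Ho := T.hasZeroObject

instance : HasShift M.Ho ℤ := T.hasShift

instance (n : ℤ) : (shiftFunctor M.Ho n).Additive := T.additive n

instance : Pretriangulated M.Ho := T.pretriangulated

instance : CategoryTheory.IsTriangulated M.Ho := T.isTriangulated

end

/-- The derived adjunction of the identity functors of `A`, where the left adjoint goes from `M`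
to `N`: a total left derived functor `left` and a total right derived functor `right` of the
identity, with the adjunction between them that is induced by the identity adjunction. -/
structure DerivedIdentityAdjunction (M N : AbelianModelStructure A) where
  left : M.Ho ⥤ N.Ho
  leftCounit : M.Q ⋙ left ⟶ 𝟭 A ⋙ N.Q
  isLeftDerived : left.IsLeftDerivedFunctor leftCounit M.W
  right : N.Ho ⥤ M.Ho
  rightUnit : 𝟭 A ⋙ M.Q ⟶ N.Q ⋙ right
  isRightDerived : right.IsRightDerivedFunctor rightUnit N.W
  adj : left ⊣ right
  unit_fac : ∀ X : A, adj.unit.app (M.Q.obj X) ≫ right.map (leftCounit.app X) = rightUnit.app X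
  counit_fac : ∀ X : A, left.map (rightUnit.app X) ≫ adj.counit.app (N.Q.obj X) = leftCounit.app X

end AbelianModelStructure

section LocalizationSequences

variable {T' T T'' : Type*} [Category* T'] [Category* T] [Category* T'']
  [HasZeroObject T'] [HasZeroObject T] [HasZeroObject T'']
  [Preadditive T'] [Preadditive T] [Preadditive T'']
  [HasShift T' ℤ] [HasShift T ℤ] [HasShift T'' ℤ]
  [∀ n : ℤ, (shiftFunctor T' n).Additive] [∀ n : ℤ, (shiftFunctor T n).Additive]
  [∀ n : ℤ, (shiftFunctor T'' n).Additive]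
  [Pretriangulated T'] [Pretriangulated T] [Pretriangulated T'']

/-- Two adjunctions `I : T' ⇄ T : R` and `L : T ⇄ T'' : J` (left adjoints `I` and `L`) form a
localization sequence of triangulated categories: all functors are triangulated, `I` and `J` are
fully faithful, and the rows `T' ⟶ T ⟶ T''` and `T'' ⟶ T ⟶ T'` are exact, i.e. the kernel
of the second functor is the essential image of the first. -/
structure IsLocalizationSequence {I : T' ⥤ T} {R : T ⥤ T'} (adj₁ : I ⊣ R)
    {L : T ⥤ T''} {J : T'' ⥤ T} (adj₂ : L ⊣ J) : Prop where
  triangulated₁ : ∃ (_ : I.CommShift ℤ) (_ : R.CommShift ℤ), adj₁.IsTriangulated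
  triangulated₂ : ∃ (_ : L.CommShift ℤ) (_ : J.CommShift ℤ), adj₂.IsTriangulated
  full₁ : I.Full
  faithful₁ : I.Faithful
  full₂ : J.Full
  faithful₂ : J.Faithful
  exact_left : ∀ X : T, IsZero (L.obj X) ↔ I.essImage X
  exact_right : ∀ X : T, IsZero (R.obj X) ↔ J.essImage X

end LocalizationSequences

end LocSeq

/-! For a localization context `(D', E') ⟶ (D, E)`, let V be the Verdier quotient of the derived
category by the triangulated subcategory generated by `D'` and `E`. The weak equivalences of the
model structure `(D, ?, E')` turn out to be the morphisms that become invertible in V. The decisive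
computation (`PerpResolutions.map_injective`, `PerpResolutions.map_surjective`) is that Hom(X, Y⟦k⟧)
does not change on passing to V if X is in `D`, Y is in `E'` and k ≥ 1. The reason is that a
morphism from X to an object of the generated subcategory factors through another such object having
no positive extensions by `E'`. Its hypotheses come from the vanishing of higher Ext
(`IsCHCotorsionPair.leftPerp`) and from (co)resolving `D'` and `E` by core objects
(`IsLocalizationContext.perpResolutions`).

Three consequences follow (`isAdapted_verdierRealization`): an object of `D` dies in V iff it lies
in `D'`; an object of `E'` dies iff it lies in `E`; and for X in `D`, Y in `E'`, the group Hom_V(X,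
Y) is Hom(X, Y) modulo the morphisms through the core. The first two identify the trivial
cofibrations and trivial fibrations, so that the two cotorsion pairs provide the two weak
factorization systems, while two-out-of-three is automatic. The third makes the homotopy category a
full subcategory of V; it is closed under shifts and cones, hence inherits a triangulation.

For composable contexts, the subcategory generated by `D''` and `E` is contained in the other two,
so the identity directly induces functors from Ho Loc(βα) to Ho Loc(α) and Ho Loc(β), compatible
with triangulated functors between the Verdier quotients. As all three contexts share one core, the
first functor is bijective on morphisms out of objects of `D'`, the second on morphisms into objects
of `E'`. Fully faithful adjoints follow formally, with essential images represented by `D'` and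
`E'`; by the vanishing criteria these are also the kernels. -/

namespace LocSeq

/-! ### Morphisms in a Verdier quotient by two classes of objects -/

section TriangulatedHull

open ZeroObject

variable {𝒟 : Type*} [Category* 𝒟] [HasZeroObject 𝒟] [HasShift 𝒟 ℤ] [Preadditive 𝒟]
  [∀ n : ℤ, (shiftFunctor 𝒟 n).Additive] [Pretriangulated 𝒟]

lemma exists_desc_of_distTriang {X Y Z W : 𝒟} {f : X ⟶ Y} {g : Y ⟶ Z} {h : Z ⟶ X⟦(1 : ℤ)⟧}
    (hT : Triangle.mk f g h ∈ distTriang 𝒟) (u : Y ⟶ W) (hu : f ≫ u = 0) :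
    ∃ v : Z ⟶ W, u = g ≫ v :=
  Triangle.yoneda_exact₂ _ hT u hu

lemma exists_lift_of_distTriang {X Y Z W : 𝒟} {f : X ⟶ Y} {g : Y ⟶ Z} {h : Z ⟶ X⟦(1 : ℤ)⟧}
    (hT : Triangle.mk f g h ∈ distTriang 𝒟) (u : W ⟶ Y) (hu : u ≫ g = 0) :
    ∃ v : W ⟶ X, u = v ≫ f :=
  Triangle.coyoneda_exact₂ _ hT u hu

lemma exists_extension_of_distTriang {X Y Z W : 𝒟} {f : X ⟶ Y} {g : Y ⟶ Z}
    {h : Z ⟶ X⟦(1 : ℤ)⟧} (hT : Triangle.mk f g h ∈ distTriang 𝒟) (u : X ⟶ W)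
    (hu : ∀ v : Z⟦(-1 : ℤ)⟧ ⟶ W, v = 0) : ∃ v : Y ⟶ W, u = f ≫ v :=
  Triangle.yoneda_exact₂ _ (inv_rot_of_distTriang _ hT) u (hu _)

/-- The smallest replete triangulated subcategory containing `P`. -/
inductive triangulatedHull (P : ObjectProperty 𝒟) : ObjectProperty 𝒟
  | of (X : 𝒟) : P X → triangulatedHull P X
  | zero (X : 𝒟) : IsZero X → triangulatedHull P X
  | iso (X Y : 𝒟) : (X ≅ Y) → triangulatedHull P X → triangulatedHull P Y
  | shift (X : 𝒟) (n : ℤ) : triangulatedHull P X → triangulatedHull P (X⟦n⟧)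
  | ext (T : Triangle 𝒟) : T ∈ distTriang 𝒟 → triangulatedHull P T.obj₁ →
      triangulatedHull P T.obj₃ → triangulatedHull P T.obj₂

variable (P : ObjectProperty 𝒟)

instance : (triangulatedHull P).IsClosedUnderIsomorphisms where
  of_iso e h := .iso _ _ e h

instance : (triangulatedHull P).IsTriangulated where
  exists_zero := ⟨0, isZero_zero _, .zero _ (isZero_zero _)⟩
  isStableUnderShiftBy n := { le_shift := fun X h => .shift X n h }
  toIsTriangulatedClosed₂ := .mk' fun T hT h₁ h₃ => .ext T hT h₁ h₃

lemma triangulatedHull_le {P Q : ObjectProperty 𝒟} [Q.IsTriangulated]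
    [Q.IsClosedUnderIsomorphisms] (h : P ≤ Q) : triangulatedHull P ≤ Q := by
  intro X hX
  induction hX with
  | of X hX => exact h _ hX
  | zero X hX => exact Q.prop_of_isZero hX
  | iso X Y e _ ih => exact Q.prop_of_iso e ih
  | shift X n _ ih => exact Q.le_shift n _ ih
  | ext T hT _ _ h₁ h₃ => exact Q.ext_of_isTriangulatedClosed₂ T hT h₁ h₃

variable {A : Type*} [Category* A] (S : A ⥤ 𝒟)

/-- The objects of `𝒟` without nonzero morphisms to the positive shifts of the objects of `F`. -/
def leftPerp (F : ObjectProperty A) : ObjectProperty 𝒟 := fun X =>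
  ∀ ⦃E : A⦄, F E → ∀ k : ℤ, 1 ≤ k → ∀ f : X ⟶ (S.obj E)⟦k⟧, f = 0

variable {S} {F F' : ObjectProperty A}

omit [HasZeroObject 𝒟] [∀ n : ℤ, (shiftFunctor 𝒟 n).Additive] [Pretriangulated 𝒟] in
lemma leftPerp_antitone (h : F ≤ F') : leftPerp S F' ≤ leftPerp S F :=
  fun _ hX _ hE k hk f => hX (h _ hE) k hk f

omit [HasZeroObject 𝒟] [Pretriangulated 𝒟] in
lemma leftPerp.shift {X : 𝒟} (hX : leftPerp S F X) (n : ℤ) (hn : n ≤ 0) :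
    leftPerp S F (X⟦n⟧) := by
  intro E hE k hk f
  have h := hX hE (k - n) (by lia)
    ((shiftFunctorCompIsoId 𝒟 n (-n) (by lia)).inv.app X ≫ f⟦-n⟧' ≫
      (shiftFunctorAdd' 𝒟 k (-n) (k - n) (by lia)).inv.app (S.obj E))
  apply (shiftFunctor 𝒟 (-n)).map_injective
  rw [Functor.map_zero, ← cancel_epi ((shiftFunctorCompIsoId 𝒟 n (-n) (by lia)).inv.app X),
    ← cancel_mono ((shiftFunctorAdd' 𝒟 k (-n) (k - n) (by lia)).inv.app (S.obj E))]
  simpa using h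

lemma leftPerp.ext₂ {T : Triangle 𝒟} (hT : T ∈ distTriang 𝒟) (h₁ : leftPerp S F T.obj₁)
    (h₃ : leftPerp S F T.obj₃) : leftPerp S F T.obj₂ := by
  intro E hE k hk f
  obtain ⟨g, rfl⟩ := T.yoneda_exact₂ hT f (h₁ hE k hk _)
  rw [h₃ hE k hk g, comp_zero]

lemma leftPerp.ext₁ {T : Triangle 𝒟} (hT : T ∈ distTriang 𝒟) (h₂ : leftPerp S F T.obj₂)
    (h₃ : leftPerp S F T.obj₃) : leftPerp S F T.obj₁ :=
  leftPerp.ext₂ (inv_rot_of_distTriang _ hT) (h₃.shift (-1) (by lia)) h₂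

variable (S) in
/-- Every morphism to `w` from an object of `leftPerp S F'` factors through an object
of `R` in `leftPerp S F`. -/
def PerpFactorizing (R : ObjectProperty 𝒟) (F F' : ObjectProperty A) : ObjectProperty 𝒟 :=
  fun w => ∀ ⦃X : 𝒟⦄, leftPerp S F' X → ∀ f : X ⟶ w,
    ∃ (c : 𝒟) (a : X ⟶ c) (b : c ⟶ w), leftPerp S F c ∧ R c ∧ a ≫ b = f

variable {R : ObjectProperty 𝒟}

instance : (PerpFactorizing S R F F').IsClosedUnderIsomorphisms where
  of_iso e h X hX f := by
    obtain ⟨c, a, b, hc, hc', fac⟩ := h hX (f ≫ e.inv)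
    exact ⟨c, a, b ≫ e.hom, hc, hc', by rw [reassoc_of% fac, e.inv_hom_id, Category.comp_id]⟩

omit [HasZeroObject 𝒟] [∀ n : ℤ, (shiftFunctor 𝒟 n).Additive] [Pretriangulated 𝒟] in
lemma PerpFactorizing.of_self {w : 𝒟} (h : leftPerp S F w) (hR : R w) :
    PerpFactorizing S R F F' w :=
  fun _ _ f => ⟨w, f, 𝟙 _, h, hR, Category.comp_id _⟩

lemma PerpFactorizing.of_zero [R.IsTriangulated] [R.IsClosedUnderIsomorphisms] {w : 𝒟}
    (h : ∀ ⦃X : 𝒟⦄, leftPerp S F' X → ∀ f : X ⟶ w, f = 0) :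
    PerpFactorizing S R F F' w :=
  fun _ hX f => ⟨0, 0, 0, fun _ _ _ _ _ => (isZero_zero 𝒟).eq_of_src _ _, R.prop_zero, by
    rw [h hX f, comp_zero]⟩

/-- Factor the component in `T.obj₃` through some `c₂`, then factor through some `c₁` the induced
morphism from the fibre `X'` of `X ⟶ c₂` to `T.obj₁`. By the octahedral axiom the cone `c` of `X'' ⟶
X` is an extension of `c₂` by `c₁`, and `f` descends to it because `f` vanishes on `X''`. The
inclusion `F' ≤ F` is what keeps `X'` in `leftPerp S F'`. -/
lemma PerpFactorizing.ext₂ [CategoryTheory.IsTriangulated 𝒟] [R.IsTriangulated]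
    [R.IsClosedUnderIsomorphisms] (hF : F' ≤ F) {T : Triangle 𝒟} (hT : T ∈ distTriang 𝒟)
    (h₁ : PerpFactorizing S R F F' T.obj₁) (h₃ : PerpFactorizing S R F F' T.obj₃) :
    PerpFactorizing S R F F' T.obj₂ := by
  intro X hX f
  obtain ⟨c₂, a₂, b₂, hc₂, hc₂', fac₂⟩ := h₃ hX (f ≫ T.mor₂)
  obtain ⟨X', i, d, hi⟩ := distinguished_cocone_triangle₁ a₂
  have hX' : leftPerp S F' X' := leftPerp.ext₁ hi hX (leftPerp_antitone hF _ hc₂)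
  have hia : i ≫ a₂ = 0 := comp_distTriang_mor_zero₁₂ _ hi
  obtain ⟨φ, hφ⟩ := T.coyoneda_exact₂ hT (i ≫ f) (by
    rw [Category.assoc, ← fac₂, reassoc_of% hia, zero_comp])
  obtain ⟨c₁, a₁, b₁, hc₁, hc₁', fac₁⟩ := h₁ hX' φ
  obtain ⟨X'', j, d', hj⟩ := distinguished_cocone_triangle₁ a₁
  have hja : j ≫ a₁ = 0 := comp_distTriang_mor_zero₁₂ _ hj
  obtain ⟨c, a, d'', hc⟩ := distinguished_cocone_triangle (j ≫ i)
  have oct := Triangulated.someOctahedron rfl hj hi hc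
  obtain ⟨b, hb⟩ := exists_desc_of_distTriang hc f (by
    rw [Category.assoc, hφ, ← fac₁, Category.assoc, reassoc_of% hja, zero_comp])
  exact ⟨c, a, b, leftPerp.ext₂ oct.mem hc₁ hc₂,
    R.ext_of_isTriangulatedClosed₂ _ oct.mem hc₁' hc₂', hb.symm⟩

variable {Cw : ObjectProperty A}

/-- The triangulated subcategory generated by `S(Cw)` and `S(Fw)`. -/
abbrev trivialHull (S : A ⥤ 𝒟) (Cw Fw : ObjectProperty A) : ObjectProperty 𝒟 :=
  triangulatedHull ((Cw ⊔ Fw).map S)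

lemma trivialHull_left {E : A} (Fw : ObjectProperty A) (hE : Cw E) :
    trivialHull S Cw Fw (S.obj E) := .of _ (ObjectProperty.prop_map_obj _ _ (Or.inl hE))

lemma trivialHull_right {Fw : ObjectProperty A} (Cw : ObjectProperty A) {E : A} (hE : Fw E) :
    trivialHull S Cw Fw (S.obj E) := .of _ (ObjectProperty.prop_map_obj _ _ (Or.inr hE))

lemma trivialHull_monotone {Cw Cw' Fw Fw' : ObjectProperty A} (h : Cw ≤ Cw') (h' : Fw ≤ Fw') :
    trivialHull S Cw Fw ≤ trivialHull S Cw' Fw' :=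
  triangulatedHull_le fun _ ⟨E, hE, ⟨e⟩⟩ =>
    .of _ ⟨E, hE.elim (fun h₁ => Or.inl (h _ h₁)) (fun h₁ => Or.inr (h' _ h₁)), ⟨e⟩⟩

variable (S) in
/-- Conditions on classes `Cw`, `F`, `Fw` which allow to compute morphisms in the Verdier quotient
by the triangulated subcategory generated by `Cw` and `Fw`. -/
structure PerpResolutions (Cw F Fw : ObjectProperty A) : Prop where
  le : Fw ≤ F
  perp : ∀ ⦃E : A⦄, Cw E → leftPerp S F (S.obj E)
  coresolve : ∀ ⦃E : A⦄, Cw E → ∃ (Y Z : A) (f : S.obj E ⟶ S.obj Y) (g : S.obj Y ⟶ S.obj Z)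
    (h : S.obj Z ⟶ (S.obj E)⟦(1 : ℤ)⟧), Triangle.mk f g h ∈ distTriang 𝒟 ∧ Fw Y ∧ Cw Z
  resolve : ∀ ⦃E : A⦄, Fw E → ∃ (Y Z : A) (f : S.obj Y ⟶ S.obj Z) (g : S.obj Z ⟶ S.obj E)
    (h : S.obj E ⟶ (S.obj Y)⟦(1 : ℤ)⟧), Triangle.mk f g h ∈ distTriang 𝒟 ∧ Fw Y ∧ Cw Z

namespace PerpResolutions

variable {Fw : ObjectProperty A} (H : PerpResolutions S Cw F Fw)
include H

omit H in
lemma perpFactorizing_right_pos {E : A} (hE : Fw E) (n : ℤ) (hn : 1 ≤ n) :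
    PerpFactorizing S (trivialHull S Cw Fw) F Fw ((S.obj E)⟦n⟧) :=
  .of_zero fun _ hX f => hX hE n hn f

lemma perpFactorizing_left_nonpos {E : A} (hE : Cw E) (n : ℤ) (hn : n ≤ 0) :
    PerpFactorizing S (trivialHull S Cw Fw) F Fw ((S.obj E)⟦n⟧) :=
  .of_self ((H.perp hE).shift n hn) (.shift _ _ (trivialHull_left _ hE))

variable [CategoryTheory.IsTriangulated 𝒟]

/-- Descending induction from the shift `m = 1`, where all relevant morphisms vanish. The resolution
of `E` exhibits `E⟦m⟧` as an extension of `Y⟦m + 1⟧` by `Z⟦m⟧`, and for `m ≤ 0` the object `Z⟦m⟧`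
already has no positive extensions by `F`. -/
lemma perpFactorizing_right (n : ℕ) : ∀ {E : A} (_ : Fw E) (m : ℤ) (_ : m = 1 - n),
    PerpFactorizing S (trivialHull S Cw Fw) F Fw ((S.obj E)⟦m⟧) := by
  induction n with
  | zero => intro E hE m hm; exact perpFactorizing_right_pos hE m (by lia)
  | succ n ih =>
    intro E hE m hm
    obtain ⟨Y, Z, f, g, h, hT, hY, hZ⟩ := H.resolve hE
    refine PerpFactorizing.ext₂ H.le (rot_of_distTriang _ (Triangle.shift_distinguished _ hT m))
      (H.perpFactorizing_left_nonpos hZ m (by lia)) ?_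
    exact (PerpFactorizing S _ F Fw).prop_of_iso
      ((shiftFunctorAdd' 𝒟 m 1 (m + 1) rfl).app _) (ih hY (m + 1) (by lia))

/-- Ascending induction: the coresolution exhibits `E⟦n + 1⟧` as an extension of `Y⟦n + 1⟧`, which
receives only zero morphisms, by `Z⟦n⟧`. -/
lemma perpFactorizing_left (n : ℕ) : ∀ {E : A} (_ : Cw E),
    PerpFactorizing S (trivialHull S Cw Fw) F Fw ((S.obj E)⟦(n : ℤ)⟧) := by
  induction n with
  | zero => intro E hE; exact H.perpFactorizing_left_nonpos hE _ (by simp)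
  | succ n ih =>
    intro E hE
    obtain ⟨Y, Z, f, g, h, hT, hY, hZ⟩ := H.coresolve hE
    refine PerpFactorizing.ext₂ H.le
      (inv_rot_of_distTriang _ (Triangle.shift_distinguished _ hT ((n + 1 : ℕ) : ℤ))) ?_
      (perpFactorizing_right_pos hY _ (by simp))
    exact (PerpFactorizing S _ F Fw).prop_of_iso
      ((shiftFunctorAdd' 𝒟 ((n + 1 : ℕ) : ℤ) (-1) n (by simp)).app _) (ih hZ)

lemma perpFactorizing {X : 𝒟} (hX : trivialHull S Cw Fw X) (n : ℤ) :
    PerpFactorizing S (trivialHull S Cw Fw) F Fw (X⟦n⟧) := by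
  induction hX generalizing n with
  | of X hX =>
    obtain ⟨E, hE, ⟨e⟩⟩ := hX
    refine ObjectProperty.prop_of_iso _ ((shiftFunctor 𝒟 n).mapIso e) ?_
    obtain hn | hn := le_total n 0
    · obtain hE | hE := hE
      · exact H.perpFactorizing_left_nonpos hE n hn
      · exact H.perpFactorizing_right (1 - n).toNat hE n (by lia)
    · obtain hE | hE := hE
      · lift n to ℕ using hn
        exact H.perpFactorizing_left n hE
      · obtain hn | rfl := hn.lt_or_eq
        · exact perpFactorizing_right_pos hE n (by lia)
        · exact H.perpFactorizing_right 1 hE 0 (by simp)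
  | zero X hX =>
    exact .of_zero fun Y _ f => ((shiftFunctor 𝒟 n).map_isZero hX).eq_of_tgt _ _
  | iso X Y e _ ih => exact ObjectProperty.prop_of_iso _ ((shiftFunctor 𝒟 n).mapIso e) (ih n)
  | shift X m _ ih =>
    exact ObjectProperty.prop_of_iso _ ((shiftFunctorAdd' 𝒟 m n _ rfl).app X) (ih (m + n))
  | ext T hT _ _ h₁ h₃ =>
    exact PerpFactorizing.ext₂ H.le (Triangle.shift_distinguished _ hT n) (h₁ n) (h₃ n)

lemma exists_factorization {X w : 𝒟} (hX : leftPerp S Fw X) (hw : trivialHull S Cw Fw w)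
    (f : X ⟶ w) : ∃ (c : 𝒟) (a : X ⟶ c) (b : c ⟶ w), leftPerp S F c ∧
      trivialHull S Cw Fw c ∧ a ≫ b = f :=
  ObjectProperty.prop_of_iso _ ((shiftFunctorZero 𝒟 ℤ).app w) (H.perpFactorizing hw 0) hX f

/-- If `f` and `g` agree in the quotient, `f - g` factors through an object of the hull, hence
through some `c` in `leftPerp S F`, which has no nonzero morphism to the target. -/
lemma map_injective {V : Type*} [Category* V] (Q : 𝒟 ⥤ V)
    [Q.IsLocalization (trivialHull S Cw Fw).trW] {X : 𝒟} (hX : leftPerp S Fw X) {E : A}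
    (hE : F E) {k : ℤ} (hk : 1 ≤ k) {f g : X ⟶ (S.obj E)⟦k⟧} (hfg : Q.map f = Q.map g) :
    f = g := by
  obtain ⟨X', s, ⟨w, q, d, hT, hw⟩, h⟩ :=
    (MorphismProperty.map_eq_iff_precomp Q (trivialHull S Cw Fw).trW f g).1 hfg
  obtain ⟨r, hr⟩ := exists_desc_of_distTriang hT (f - g) (by
    rw [Preadditive.comp_sub, h, sub_self])
  obtain ⟨c, a, b, hc, -, rfl⟩ := H.exists_factorization hX hw q
  rwa [Category.assoc, hc hE k hk (b ≫ r), comp_zero, sub_eq_zero] at hr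

/-- The denominator `s` of a fraction can be refined to a morphism `j` whose cone `c` lies in
`leftPerp S F`. The numerator then extends along `j`, since the obstruction is a morphism from
`c⟦-1⟧` to a positive shift of an object of `F`. -/
lemma map_surjective {V : Type*} [Category* V] (Q : 𝒟 ⥤ V)
    [Q.IsLocalization (trivialHull S Cw Fw).trW] {X : 𝒟} (hX : leftPerp S Fw X) {E : A}
    (hE : F E) {k : ℤ} (hk : 1 ≤ k) (φ : Q.obj X ⟶ Q.obj ((S.obj E)⟦k⟧)) :
    ∃ f : X ⟶ (S.obj E)⟦k⟧, Q.map f = φ := by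
  obtain ⟨ψ, rfl⟩ := Localization.exists_rightFraction Q (trivialHull S Cw Fw).trW φ
  obtain ⟨X', s, hs, g, rfl⟩ := ψ.cases
  have hs' := hs
  obtain ⟨w, q, d, hT, hw⟩ := hs'
  obtain ⟨c, a, b, hc, hc', fac⟩ := H.exists_factorization hX hw q
  obtain ⟨X'', j, d', hj⟩ := distinguished_cocone_triangle₁ a
  have hja : j ≫ a = 0 := comp_distTriang_mor_zero₁₂ _ hj
  obtain ⟨t, ht⟩ := exists_lift_of_distTriang hT j (by
    rw [← fac, reassoc_of% hja, zero_comp])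
  obtain ⟨f, hf⟩ := exists_extension_of_distTriang hj (t ≫ g)
    (hc.shift (-1) (by lia) hE k hk)
  have hQj : IsIso (Q.map j) :=
    Localization.inverts Q (trivialHull S Cw Fw).trW j ⟨_, _, _, hj, hc'⟩
  have hQs : IsIso (Q.map s) := Localization.inverts Q (trivialHull S Cw Fw).trW s hs
  have hQt : IsIso (Q.map t) := by
    rw [ht, Q.map_comp] at hQj
    exact IsIso.of_isIso_comp_right _ (Q.map s)
  refine ⟨f, ?_⟩
  rw [← cancel_epi (Q.map s)]
  refine Eq.trans ?_ (MorphismProperty.RightFraction.map_s_comp_map ⟨s, hs, g⟩ Q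
    (Localization.inverts Q _)).symm
  rw [← cancel_epi (Q.map t), ← Q.map_comp_assoc, ← ht, ← Q.map_comp, ← hf, Q.map_comp]

end PerpResolutions

end TriangulatedHull

universe w'

/-! ### Effaceability and vanishing of higher Ext groups -/

section Ext

variable {A : Type u} [Category.{v} A] [Abelian A]

section

open HomologicalComplex

/-- As `K` vanishes above degree `i`, its term in degree `i` consists of cycles: it surjects onto
the homology, which is `X`, and it maps to `K` as a complex concentrated in degree `i`. -/
lemma exists_epi_homologicalComplex_single_map_factors {X : A} {K : CochainComplex A ℤ} {i : ℤ}
    (π : K ⟶ (single A (ComplexShape.up ℤ) i).obj X) [K.IsStrictlyLE i] [QuasiIsoAt π i] :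
    ∃ (X' : A) (p : X' ⟶ X) (t : (single A (ComplexShape.up ℤ) i).obj X' ⟶ K),
      Epi p ∧ (single A (ComplexShape.up ℤ) i).map p = t ≫ π := by
  let e := K.iCyclesIso i (i + 1) (by simp)
    ((K.isZero_of_isStrictlyLE i (i + 1) (by simp)).eq_of_tgt _ _)
  let α := e.inv ≫ K.homologyπ i ≫ homologyMap π i ≫ (singleObjHomologySelfIso _ _ _).hom
  have : π.f i = α ≫ (singleObjXSelf (ComplexShape.up ℤ) i X).inv := by
    rw [← cancel_epi e.hom]
    dsimp only [α]
    rw [Category.assoc, Category.assoc, Category.assoc, Iso.hom_inv_id_assoc,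
      homologyπ_naturality_assoc, homologyπ_singleObjHomologySelfIso_hom_assoc,
      ← singleObjCyclesSelfIso_inv_iCycles, Iso.hom_inv_id_assoc, cyclesMap_i]
    rfl
  refine ⟨K.X i, α, mkHomFromSingle (𝟙 _) (by
    rintro _ rfl
    apply (K.isZero_of_isStrictlyLE i (i + 1) (by simp)).eq_of_tgt), inferInstance, ?_⟩
  apply HomologicalComplex.from_single_hom_ext
  rw [comp_f, mkHomFromSingle_f, Category.comp_id, this]
  exact single_map_f_self _ _ _

lemma exists_epi_single_map_factors {X : A} {K : CochainComplex A ℤ} {i : ℤ}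
    (π : K ⟶ (CochainComplex.singleFunctor A i).obj X) [K.IsStrictlyLE i] [QuasiIsoAt π i] :
    ∃ (X' : A) (p : X' ⟶ X) (t : (CochainComplex.singleFunctor A i).obj X' ⟶ K),
      Epi p ∧ (CochainComplex.singleFunctor A i).map p = t ≫ π :=
  have : QuasiIsoAt (L := (single A (ComplexShape.up ℤ) i).obj X) π i := ‹QuasiIsoAt π i›
  exists_epi_homologicalComplex_single_map_factors π

end

variable [HasDerivedCategory.{w'} A]

open DerivedCategory

/-- Write `f` as a fraction through a complex `K` in degrees ≤ 0. After pulling back to `X'`, the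
numerator starts from an object in degree 0, where `L` is zero. -/
lemma exists_epi_map_comp_eq_zero_of_isStrictlyLE {X : A} {L : CochainComplex A ℤ} {n : ℤ}
    [L.IsStrictlyLE n] (hn : n < 0)
    (f : Q.obj ((CochainComplex.singleFunctor A 0).obj X) ⟶ Q.obj L) :
    ∃ (X' : A) (p : X' ⟶ X), Epi p ∧
      Q.map ((CochainComplex.singleFunctor A 0).map p) ≫ f = 0 := by
  obtain ⟨K, _, π, h, g, rfl⟩ := right_fac_of_isStrictlyLE f 0
  have : QuasiIsoAt π 0 := by
    rw [isIso_Q_map_iff_quasiIso] at h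
    infer_instance
  obtain ⟨X', p, t, hp, fac⟩ := exists_epi_single_map_factors π
  refine ⟨X', p, hp, ?_⟩
  have h₂ : t ≫ g = 0 := by
    apply HomologicalComplex.from_single_hom_ext
    apply (L.isZero_of_isStrictlyLE n 0 hn).eq_of_tgt
  rw [fac, Q.map_comp, Category.assoc, IsIso.hom_inv_id_assoc, ← Q.map_comp, h₂, Q.map_zero]

lemma exists_epi_map_comp_eq_zero {X Y : A} {k : ℤ} (hk : 1 ≤ k)
    (f : (singleFunctor A 0).obj X ⟶ ((singleFunctor A 0).obj Y)⟦k⟧) :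
    ∃ (X' : A) (p : X' ⟶ X), Epi p ∧ (singleFunctor A 0).map p ≫ f = 0 := by
  obtain ⟨X', p, hp, h⟩ := exists_epi_map_comp_eq_zero_of_isStrictlyLE
    (L := (CochainComplex.singleFunctor A (-k)).obj Y) (n := -k) (by lia)
    (f ≫ ((singleFunctors A).shiftIso k (-k) 0 (by lia)).hom.app _)
  refine ⟨X', p, hp, ?_⟩
  rw [← cancel_mono (((singleFunctors A).shiftIso k (-k) 0 (by lia)).hom.app _),
    Category.assoc, zero_comp]
  exact h

lemma subsingleton_ext_one_iff [HasExt.{w} A] (X Y : A) :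
    Subsingleton (Ext.{w} X Y 1) ↔
      ∀ f : (singleFunctor A 0).obj X ⟶ ((singleFunctor A 0).obj Y)⟦(1 : ℤ)⟧, f = 0 := by
  refine ⟨fun _ f => ?_, fun h => ⟨fun a b => ?_⟩⟩
  · exact (Ext.homEquiv (n := 1)).symm.injective (Subsingleton.elim _ _)
  · exact (Ext.homEquiv (n := 1)).injective ((h _).trans (h _).symm)

/-- Short exact sequences induce distinguished triangles. -/
lemma distTriang_single {X Y Z : A} {i : X ⟶ Y} {p : Y ⟶ Z} {h : i ≫ p = 0}
    (hS : (ShortComplex.mk i p h).ShortExact) :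
    Triangle.mk ((singleFunctor A 0).map i) ((singleFunctor A 0).map p) hS.singleδ ∈
      distTriang (DerivedCategory A) :=
  hS.singleTriangle_distinguished

lemma IsCotorsionPair.hom_eq_zero [HasExt.{w} A] {D E : ObjectProperty A}
    (h : IsCotorsionPair.{w} D E) {X Y : A} (hX : D X) (hY : E Y)
    (f : (singleFunctor A 0).obj X ⟶ ((singleFunctor A 0).obj Y)⟦(1 : ℤ)⟧) : f = 0 :=
  (subsingleton_ext_one_iff X Y).1 ((h.left_iff X).1 hX Y hY) f

lemma IsCotorsionPair.left_of_forall [HasExt.{w} A] {D E : ObjectProperty A}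
    (h : IsCotorsionPair.{w} D E) {X : A} (hX : ∀ Y : A, E Y →
      ∀ f : (singleFunctor A 0).obj X ⟶ ((singleFunctor A 0).obj Y)⟦(1 : ℤ)⟧, f = 0) : D X :=
  (h.left_iff X).2 fun Y hY => (subsingleton_ext_one_iff X Y).2 (hX Y hY)

lemma IsCotorsionPair.right_of_forall [HasExt.{w} A] {D E : ObjectProperty A}
    (h : IsCotorsionPair.{w} D E) {Y : A} (hY : ∀ X : A, D X →
      ∀ f : (singleFunctor A 0).obj X ⟶ ((singleFunctor A 0).obj Y)⟦(1 : ℤ)⟧, f = 0) : E Y :=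
  (h.right_iff Y).2 fun X hX => (subsingleton_ext_one_iff X Y).2 (hY X hX)

omit [HasDerivedCategory.{w'} A] in
lemma shortExact_kernel {X Y : A} (p : X ⟶ Y) [Epi p] :
    (ShortComplex.mk _ _ (kernel.condition p)).ShortExact where
  exact := ShortComplex.exact_of_f_is_kernel _ (kernelIsKernel p)

omit [HasDerivedCategory.{w'} A] in
lemma shortExact_cokernel {X Y : A} (i : X ⟶ Y) [Mono i] :
    (ShortComplex.mk _ _ (cokernel.condition i)).ShortExact where
  exact := ShortComplex.exact_of_g_is_cokernel _ (cokernelIsCokernel i)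

/-- In a complete hereditary cotorsion pair, all higher `Ext` groups vanish. -/
lemma IsCHCotorsionPair.leftPerp [HasExt.{w} A] {D E : ObjectProperty A}
    (h : IsCHCotorsionPair.{w} D E) {X : A} (hX : D X) :
    leftPerp (singleFunctor A 0) E ((singleFunctor A 0).obj X) := by
  intro Y hY k hk f
  obtain ⟨n, hn⟩ : ∃ n : ℕ, k = n + 1 := ⟨(k - 1).toNat, by lia⟩
  induction n generalizing X k with
  | zero =>
    obtain rfl : k = 1 := by simpa using hn
    exact h.cotorsion.hom_eq_zero hX hY f
  | succ n ih =>
    -- Dimension shift: `f` dies on an epimorphism from some `M'` in `D`, whose kernel is again in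
    -- `D` by heredity. So `f` comes from a morphism from the shifted kernel to `Y⟦k⟧`, which
    -- desuspends to the case `k - 1`.
    obtain ⟨M, q, hq, hqf⟩ := exists_epi_map_comp_eq_zero hk f
    obtain ⟨_, M', i, p, w, hS, -, hM'⟩ := h.complete.enough_projectives M
    have : Epi p := hS.epi_g
    have hS' := shortExact_kernel (p ≫ q)
    obtain ⟨g, hg⟩ := exists_desc_of_distTriang (rot_of_distTriang _ (distTriang_single hS')) f
      (by
        change (singleFunctor A 0).map (p ≫ q) ≫ f = 0
        rw [Functor.map_comp, Category.assoc, hqf, comp_zero])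
    have hg' : (shiftFunctorAdd' (DerivedCategory A) 1 (-1) 0 (by simp)).hom.app _ ≫
        g⟦(-1 : ℤ)⟧' ≫ (shiftFunctorAdd' (DerivedCategory A) k (-1) (k - 1)
          (by lia)).inv.app _ = 0 := by
      have hK := h.hereditary.resolving _ hS' hM' hX
      rw [← cancel_epi ((shiftFunctorZero (DerivedCategory A) ℤ).inv.app _), comp_zero]
      exact ih hK (k - 1) (by lia) _ (by lia)
    have hg0 : g = 0 := by
      apply (shiftFunctor _ (-1 : ℤ)).map_injective
      rw [← cancel_epi ((shiftFunctorAdd' (DerivedCategory A) 1 (-1) 0 (by simp)).hom.app _),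
        ← cancel_mono ((shiftFunctorAdd' (DerivedCategory A) k (-1) (k - 1)
          (by lia)).inv.app _), Category.assoc, hg']
      simp
    rw [hg, hg0]
    exact comp_zero

end Ext

/-! ### Pushouts of short exact sequences; monomorphisms and epimorphisms with prescribed cokernel
or kernel -/

section AbelianCategory

variable {A : Type u} [Category.{v} A] [Abelian A]

lemma shortExact_biprod (X Y : A) : (ShortComplex.mk (biprod.inl : X ⟶ X ⊞ Y)
    (biprod.snd : X ⊞ Y ⟶ Y) (by simp)).ShortExact where
  exact := (ShortComplex.Splitting.ofHasBinaryBiproduct X Y).exact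

lemma shortExact_of_isPushout {K X Y E P : A} {i : K ⟶ X} {p : X ⟶ Y} {w : i ≫ p = 0}
    (hS : (ShortComplex.mk i p w).ShortExact) {j : K ⟶ E} {a : X ⟶ P} {b : E ⟶ P}
    (sq : IsPushout i j a b) :
    ∃ (q : P ⟶ Y) (w' : b ≫ q = 0), (ShortComplex.mk b q w').ShortExact ∧ a ≫ q = p := by
  have : Mono i := hS.mono_f
  have : Epi p := hS.epi_g
  have hb : Mono b := (MorphismProperty.monomorphisms A).of_isPushout sq.flip
    (MorphismProperty.monomorphisms.infer_property i)
  have h₀ : i ≫ p = j ≫ (0 : E ⟶ Y) := by rw [w, comp_zero]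
  have hq : Epi (sq.desc p 0 h₀) := epi_of_epi_fac (sq.inl_desc p 0 h₀)
  refine ⟨sq.desc p 0 h₀, by simp,
    { exact := ShortComplex.exact_of_g_is_cokernel _
        (CokernelCofork.IsColimit.ofπ' _ _ fun {T} k hk => ?_)
      mono_f := hb
      epi_g := hq }, by simp⟩
  have h₁ : i ≫ a ≫ k = 0 := by
    have : b ≫ k = 0 := hk
    rw [sq.w_assoc, this, comp_zero]
  have h₂ : p ≫ hS.exact.gIsCokernel.desc (CokernelCofork.ofπ (a ≫ k) h₁) = a ≫ k :=
    hS.exact.gIsCokernel.fac (CokernelCofork.ofπ (a ≫ k) h₁) WalkingParallelPair.one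
  refine ⟨hS.exact.gIsCokernel.desc (CokernelCofork.ofπ (a ≫ k) h₁), ?_⟩
  apply sq.hom_ext
  · rw [IsPushout.inl_desc_assoc, h₂]
  · rw [IsPushout.inr_desc_assoc, zero_comp]
    exact hk.symm

/-- The third isomorphism theorem, with `Z` constructed as the pushout of `j` and `p`. -/
lemma exists_shortExact_comp {X Y M P N : A} {i : X ⟶ Y} {p : Y ⟶ M} {w : i ≫ p = 0}
    (hS : (ShortComplex.mk i p w).ShortExact) {j : Y ⟶ P} {q : P ⟶ N} {w' : j ≫ q = 0}
    (hS' : (ShortComplex.mk j q w').ShortExact) :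
    ∃ (Z : A) (r : P ⟶ Z) (h : (i ≫ j) ≫ r = 0) (b : M ⟶ Z) (c : Z ⟶ N) (h' : b ≫ c = 0),
      (ShortComplex.mk (i ≫ j) r h).ShortExact ∧ (ShortComplex.mk b c h').ShortExact := by
  have sq := IsPushout.of_hasPushout j p
  obtain ⟨c, h', hb, -⟩ := shortExact_of_isPushout hS' sq
  have : Mono i := hS.mono_f
  have : Mono j := hS'.mono_f
  have : Epi p := hS.epi_g
  have hr : Epi (pushout.inl j p) := inferInstance
  have hw : (i ≫ j) ≫ pushout.inl j p = 0 := by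
    rw [Category.assoc, sq.w, ← Category.assoc, w, zero_comp]
  refine ⟨_, pushout.inl _ _, hw, pushout.inr _ _, c, h',
    { exact := ShortComplex.exact_of_g_is_cokernel _
        (CokernelCofork.IsColimit.ofπ' _ _ fun {T} k hk => ?_)
      mono_f := mono_comp i j
      epi_g := hr }, hb⟩
  have h₁ : i ≫ j ≫ k = 0 := by simpa using hk
  have h₂ : p ≫ hS.exact.gIsCokernel.desc (CokernelCofork.ofπ (j ≫ k) h₁) = j ≫ k :=
    hS.exact.gIsCokernel.fac (CokernelCofork.ofπ (j ≫ k) h₁) WalkingParallelPair.one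
  exact ⟨pushout.desc k (hS.exact.gIsCokernel.desc (CokernelCofork.ofπ (j ≫ k) h₁)) h₂.symm,
    pushout.inl_desc _ _ _⟩

/-- The monomorphisms with cokernel in `D`. -/
def monoWithCokernel (D : ObjectProperty A) : MorphismProperty A :=
  fun _ _ f => Mono f ∧ D (cokernel f)

/-- The epimorphisms with kernel in `E`. -/
def epiWithKernel (E : ObjectProperty A) : MorphismProperty A :=
  fun _ _ f => Epi f ∧ E (kernel f)

lemma monoWithCokernel_iff (D : ObjectProperty A) [D.IsClosedUnderIsomorphisms]
    {X Y Z : A} {i : X ⟶ Y} {p : Y ⟶ Z} {w : i ≫ p = 0}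
    (hS : (ShortComplex.mk i p w).ShortExact) : monoWithCokernel D i ↔ D Z := by
  have := hS.mono_f
  have := hS.epi_g
  exact (and_iff_right hS.mono_f).trans (D.prop_iff_of_iso
    ((cokernelIsCokernel i).coconePointUniqueUpToIso hS.exact.gIsCokernel))

lemma epiWithKernel_iff (E : ObjectProperty A) [E.IsClosedUnderIsomorphisms]
    {X Y Z : A} {i : X ⟶ Y} {p : Y ⟶ Z} {w : i ≫ p = 0}
    (hS : (ShortComplex.mk i p w).ShortExact) : epiWithKernel E p ↔ E X := by
  have := hS.mono_f
  have := hS.epi_g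
  exact (and_iff_right hS.epi_g).trans (E.prop_iff_of_iso
    ((kernelIsKernel p).conePointUniqueUpToIso hS.exact.fIsKernel))

lemma monoWithCokernel_zero_iff (D : ObjectProperty A) [D.IsClosedUnderIsomorphisms] {Z X : A}
    (hZ : IsZero Z) (f : Z ⟶ X) : monoWithCokernel D f ↔ D X :=
  monoWithCokernel_iff (p := 𝟙 X) (w := hZ.eq_of_src _ _) D
    { exact := (ShortComplex.exact_iff_mono _ (hZ.eq_of_src _ _)).2 (by dsimp; infer_instance)
      mono_f := ⟨fun _ _ _ => hZ.eq_of_tgt _ _⟩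
      epi_g := by dsimp; infer_instance }

lemma epiWithKernel_zero_iff (E : ObjectProperty A) [E.IsClosedUnderIsomorphisms] {Z X : A}
    (hZ : IsZero Z) (f : X ⟶ Z) : epiWithKernel E f ↔ E X :=
  epiWithKernel_iff (i := 𝟙 X) (w := hZ.eq_of_tgt _ _) E
    { exact := (ShortComplex.exact_iff_epi _ (hZ.eq_of_tgt _ _)).2 (by dsimp; infer_instance)
      mono_f := by dsimp; infer_instance
      epi_g := ⟨fun _ _ _ => hZ.eq_of_src _ _⟩ }

instance (D : ObjectProperty A) [D.IsStableUnderRetracts] :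
    (monoWithCokernel D).IsStableUnderRetracts where
  of_retract {X Y Z W f g} h hg := by
    refine ⟨MorphismProperty.of_retract (P := MorphismProperty.monomorphisms A) h hg.1, ?_⟩
    refine D.prop_of_retract
      { i := cokernel.map f g h.i.left h.i.right h.i_w.symm
        r := cokernel.map g f h.r.left h.r.right h.r_w.symm
        retract := ?_ } hg.2
    rw [← cancel_epi (cokernel.π f)]
    simp

instance (E : ObjectProperty A) [E.IsStableUnderRetracts] :
    (epiWithKernel E).IsStableUnderRetracts where
  of_retract {X Y Z W f g} h hg := by
    refine ⟨MorphismProperty.of_retract (P := MorphismProperty.epimorphisms A) h hg.1, ?_⟩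
    refine E.prop_of_retract
      { i := kernel.map f g h.i.left h.i.right h.i_w.symm
        r := kernel.map g f h.r.left h.r.right h.r_w.symm
        retract := ?_ } hg.2
    rw [← cancel_mono (kernel.ι f)]
    simp

end AbelianCategory

section

variable {𝒟 : Type*} [Category* 𝒟] [HasZeroObject 𝒟] [HasShift 𝒟 ℤ] [Preadditive 𝒟]
  [∀ n : ℤ, (shiftFunctor 𝒟 n).Additive] [Pretriangulated 𝒟]

lemma exists_lift_of_comp_eq_zero {X Y Z W : 𝒟} {f : X ⟶ Y} {g : Y ⟶ Z} {h : Z ⟶ X⟦(1 : ℤ)⟧}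
    (hT : Triangle.mk f g h ∈ distTriang 𝒟) (u : W ⟶ Z) (hu : u ≫ h = 0) :
    ∃ v : W ⟶ Y, u = v ≫ g :=
  Triangle.coyoneda_exact₃ _ hT u hu

lemma exists_desc_of_comp_eq_zero {X Y Z W : 𝒟} {f : X ⟶ Y} {g : Y ⟶ Z} {h : Z ⟶ X⟦(1 : ℤ)⟧}
    (hT : Triangle.mk f g h ∈ distTriang 𝒟) (u : X ⟶ W) (hu : h ≫ u⟦(1 : ℤ)⟧' = 0) :
    ∃ v : Y ⟶ W, u = f ≫ v := by
  obtain ⟨v, hv⟩ : ∃ v : Y⟦(1 : ℤ)⟧ ⟶ W⟦(1 : ℤ)⟧, u⟦(1 : ℤ)⟧' = (-f⟦(1 : ℤ)⟧') ≫ v :=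
    exists_desc_of_distTriang (rot_of_distTriang _ (rot_of_distTriang _ hT)) (u⟦(1 : ℤ)⟧') hu
  obtain ⟨v, rfl⟩ := (shiftFunctor 𝒟 (1 : ℤ)).map_surjective v
  refine ⟨-v, (shiftFunctor 𝒟 (1 : ℤ)).map_injective ?_⟩
  simpa using hv

end

/-! ### Weak factorization systems from cotorsion pairs -/

section Cotorsion

variable {A : Type u} [Category.{v} A] [Abelian A] [HasDerivedCategory.{w'} A]

open DerivedCategory

/-- Both obstructions lie in Ext¹(C, K). The first is to lifting `v` through `p`: its class in
Ext¹(Y, K) restricts to zero on `X`, hence comes from `C`. The second is to extending along `i` the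
error `u - i ≫ a`, which takes values in `K`. -/
lemma hasLiftingProperty_of_forall_eq_zero {X Y X' Y' K C : A} {i : X ⟶ Y} {π : Y ⟶ C}
    {w : i ≫ π = 0} (hi : (ShortComplex.mk i π w).ShortExact) {ι : K ⟶ X'} {p : X' ⟶ Y'}
    {w' : ι ≫ p = 0} (hp : (ShortComplex.mk ι p w').ShortExact)
    (h : ∀ f : (singleFunctor A 0).obj C ⟶ ((singleFunctor A 0).obj K)⟦(1 : ℤ)⟧, f = 0) :
    HasLiftingProperty i p where
  sq_hasLift {u v} sq := by
    have := hp.mono_f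
    obtain ⟨t, ht⟩ := exists_desc_of_distTriang (distTriang_single hi)
      ((singleFunctor A 0).map v ≫ hp.singleδ) (by
        rw [← Functor.map_comp_assoc, ← sq.w, Functor.map_comp_assoc]
        have : (singleFunctor A 0).map p ≫ hp.singleδ = 0 :=
          comp_distTriang_mor_zero₂₃ _ (distTriang_single hp)
        rw [this, comp_zero])
    obtain ⟨a, ha⟩ := exists_lift_of_comp_eq_zero (distTriang_single hp)
      ((singleFunctor A 0).map v) (by rw [ht, h t, comp_zero])
    obtain ⟨a, rfl⟩ := (singleFunctor A 0).map_surjective a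
    obtain rfl : v = a ≫ p := (singleFunctor A 0).map_injective (by simpa using ha)
    have h₁ : (u - i ≫ a) ≫ p = 0 := by simp [sq.w]
    have h₂ : hp.exact.lift (u - i ≫ a) h₁ ≫ ι = u - i ≫ a := hp.exact.lift_f _ _
    obtain ⟨b, hb⟩ := exists_desc_of_comp_eq_zero (distTriang_single hi)
      ((singleFunctor A 0).map (hp.exact.lift (u - i ≫ a) h₁)) (h _)
    obtain ⟨b, rfl⟩ := (singleFunctor A 0).map_surjective b
    rw [← Functor.map_comp] at hb
    replace hb := (singleFunctor A 0).map_injective hb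
    refine ⟨⟨a + b ≫ ι, ?_, ?_⟩⟩
    · rw [Preadditive.comp_add, ← Category.assoc, ← hb, h₂]
      abel
    · simp [w']

namespace IsCotorsionPair

variable [HasExt.{w} A] {D E : ObjectProperty A} (h : IsCotorsionPair.{w} D E)
include h

lemma left_isStableUnderRetracts : D.IsStableUnderRetracts where
  of_retract r hX := h.left_of_forall fun Y hY f => by
    have := h.hom_eq_zero hX hY ((singleFunctor A 0).map r.r ≫ f)
    have h₁ : (singleFunctor A 0).map r.i ≫ (singleFunctor A 0).map r.r = 𝟙 _ := by
      rw [← Functor.map_comp, r.retract, CategoryTheory.Functor.map_id]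
    rw [← Category.id_comp f, ← h₁, Category.assoc, this, comp_zero]

lemma right_isStableUnderRetracts : E.IsStableUnderRetracts where
  of_retract r hY := h.right_of_forall fun X hX f => by
    have := h.hom_eq_zero hX hY (f ≫ ((singleFunctor A 0).map r.i)⟦(1 : ℤ)⟧')
    have h₁ : ((singleFunctor A 0).map r.i)⟦(1 : ℤ)⟧' ≫
        ((singleFunctor A 0).map r.r)⟦(1 : ℤ)⟧' = 𝟙 _ := by
      rw [← Functor.map_comp, ← Functor.map_comp, r.retract, CategoryTheory.Functor.map_id,
        CategoryTheory.Functor.map_id]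
    rw [← Category.comp_id f, ← h₁, ← Category.assoc, this, zero_comp]

lemma left_isClosedUnderIsomorphisms : D.IsClosedUnderIsomorphisms where
  of_iso e hX := h.left_isStableUnderRetracts.of_retract (Retract.ofIso e.symm) hX

lemma right_isClosedUnderIsomorphisms : E.IsClosedUnderIsomorphisms where
  of_iso e hX := h.right_isStableUnderRetracts.of_retract (Retract.ofIso e.symm) hX

lemma left_ext {X Y Z : A} {i : X ⟶ Y} {p : Y ⟶ Z} {w : i ≫ p = 0}
    (hS : (ShortComplex.mk i p w).ShortExact) (hX : D X) (hZ : D Z) : D Y :=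
  h.left_of_forall fun W hW f => by
    obtain ⟨g, rfl⟩ := exists_desc_of_distTriang (distTriang_single hS) f
      (h.hom_eq_zero hX hW _)
    rw [h.hom_eq_zero hZ hW g, comp_zero]

lemma right_ext {X Y Z : A} {i : X ⟶ Y} {p : Y ⟶ Z} {w : i ≫ p = 0}
    (hS : (ShortComplex.mk i p w).ShortExact) (hX : E X) (hZ : E Z) : E Y :=
  h.right_of_forall fun W hW f => by
    have hT := Triangle.shift_distinguished _ (distTriang_single hS) 1
    obtain ⟨g, rfl⟩ := Triangle.coyoneda_exact₂ _ hT f (h.hom_eq_zero hW hZ _)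
    rw [h.hom_eq_zero hW hX g]
    exact zero_comp

lemma exists_factorization (hc : IsCompletePair D E) {X Y : A} (f : X ⟶ Y) :
    ∃ (Z : A) (i : X ⟶ Z) (p : Z ⟶ Y), i ≫ p = f ∧ monoWithCokernel D i ∧
      epiWithKernel E p := by
  have := h.left_isClosedUnderIsomorphisms
  have := h.right_isClosedUnderIsomorphisms
  obtain ⟨_, M, _, q, _, hM, -, hMD⟩ := hc.enough_projectives Y
  have : Epi q := hM.epi_g
  have : Epi (biprod.desc f q) := epi_of_epi_fac (biprod.inr_desc f q)
  -- The map `X ⊞ M ⟶ Y` is epi, but its kernel need not be in `E`. Pushing out along an embedding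
  -- of the kernel into `E'` corrects this, and the cokernel of `X` in the pushout is an extension
  -- of `N` by `M`, both in `D`.
  obtain ⟨E', N, j, r, wj, hj, hE', hN⟩ := hc.enough_injectives (kernel (biprod.desc f q))
  have sq := IsPushout.of_hasPushout (kernel.ι (biprod.desc f q)) j
  obtain ⟨p, wp, hp, hp'⟩ := shortExact_of_isPushout (shortExact_kernel (biprod.desc f q)) sq
  obtain ⟨c, wc, hc', -⟩ := shortExact_of_isPushout hj sq.flip
  obtain ⟨Z, s, ws, b, c, wb, h₁, h₂⟩ := exists_shortExact_comp (shortExact_biprod X M) hc'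
  refine ⟨_, biprod.inl ≫ pushout.inl _ _, p, by simp [hp'], ?_, ?_⟩
  · rw [monoWithCokernel_iff D h₁]
    exact h.left_ext h₂ hMD hN
  · rwa [epiWithKernel_iff E hp]

lemma hasLiftingProperty {X Y X' Y' : A} {i : X ⟶ Y} {p : X' ⟶ Y'}
    (hi : monoWithCokernel D i) (hp : epiWithKernel E p) : HasLiftingProperty i p := by
  have := hi.1
  have := hp.1
  exact hasLiftingProperty_of_forall_eq_zero (shortExact_cokernel i) (shortExact_kernel p)
    (h.hom_eq_zero hi.2 hp.2)

lemma isWeakFactorizationSystem (hc : IsCompletePair D E) :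
    (monoWithCokernel D).IsWeakFactorizationSystem (epiWithKernel E) := by
  have := h.left_isStableUnderRetracts
  have := h.right_isStableUnderRetracts
  have : (monoWithCokernel D).HasFactorization (epiWithKernel E) := ⟨fun f => by
    obtain ⟨Z, i, p, fac, hi, hp⟩ := h.exists_factorization hc f
    exact ⟨⟨Z, i, p, fac, hi, hp⟩⟩⟩
  exact .mk' _ _ fun _ _ hi hp => h.hasLiftingProperty hi hp

end IsCotorsionPair

namespace IsLocalizationContext

variable [HasExt.{w} A] {D' E' D E : ObjectProperty A}

lemma right_le (h : IsLocalizationContext.{w} D' E' D E) : E ≤ E' := fun _ hY =>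
  h.source.cotorsion.right_of_forall fun _ hX => h.target.cotorsion.hom_eq_zero (h.le _ hX) hY

omit [HasDerivedCategory.{w'} A] in
lemma right_of_core (h : IsLocalizationContext.{w} D' E' D E) {X : A} (h₁ : D' X) (h₂ : E' X) :
    E X :=
  ((congrFun h.core_eq X).mp ⟨h₁, h₂⟩).2

omit [HasDerivedCategory.{w'} A] in
lemma left_of_core (h : IsLocalizationContext.{w} D' E' D E) {X : A} (h₁ : D X) (h₂ : E X) :
    D' X :=
  ((congrFun h.core_eq X).mpr ⟨h₁, h₂⟩).1

omit [HasDerivedCategory.{w'} A] in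
lemma comp {D'' E'' : ObjectProperty A} (a : IsLocalizationContext.{w} D'' E'' D' E')
    (b : IsLocalizationContext.{w} D' E' D E) : IsLocalizationContext.{w} D'' E'' D E where
  source := a.source
  target := b.target
  core_eq := a.core_eq.trans b.core_eq
  le := a.le.trans b.le

/-- The middle terms of the approximation sequences lie in the core: an object of `D'` embeds into
one of `D' ∩ E'`, hence of `E`; an object of `E` is a quotient of one of `D ∩ E`, hence of `D'`. -/
lemma perpResolutions (h : IsLocalizationContext.{w} D' E' D E) :
    PerpResolutions (singleFunctor A 0) D' E' E where
  le := h.right_le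
  perp _ hX := h.source.leftPerp hX
  coresolve X hX := by
    obtain ⟨Y, Z, i, p, w, hS, hY, hZ⟩ := h.source.complete.enough_injectives X
    exact ⟨Y, Z, _, _, _, distTriang_single hS,
      h.right_of_core (h.source.cotorsion.left_ext hS hX hZ) hY, hZ⟩
  resolve X hX := by
    obtain ⟨Y, Z, i, p, w, hS, hY, hZ⟩ := h.target.complete.enough_projectives X
    exact ⟨Y, Z, _, _, _, distTriang_single hS, hY,
      h.left_of_core hZ (h.target.cotorsion.right_ext hS hY hX)⟩

end IsLocalizationContext

end Cotorsion

/-! ### The realization of a localization context in a Verdier quotient -/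

section Realization

/-- A functor from an abelian category to a pretriangulated category which sends short exact
sequences to distinguished triangles, in a natural way. -/
structure ExactRealization (A : Type*) [Category* A] [Abelian A] (V : Type*) [Category* V]
    [HasZeroObject V] [HasShift V ℤ] [Preadditive V] [∀ n : ℤ, (shiftFunctor V n).Additive]
    [Pretriangulated V] where
  functor : A ⥤ V
  additive : functor.Additive
  δ : ∀ S : ShortComplex A, S.ShortExact → (functor.obj S.X₃ ⟶ (functor.obj S.X₁)⟦(1 : ℤ)⟧)
  δ_naturality : ∀ (S S' : ShortComplex A) (hS : S.ShortExact) (hS' : S'.ShortExact)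
    (φ : S ⟶ S'), δ S hS ≫ (functor.map φ.τ₁)⟦(1 : ℤ)⟧' = functor.map φ.τ₃ ≫ δ S' hS'
  distinguished : ∀ (S : ShortComplex A) (hS : S.ShortExact),
    Triangle.mk (functor.map S.f) (functor.map S.g) (δ S hS) ∈ distTriang V

attribute [instance] ExactRealization.additive

namespace ExactRealization

variable {A : Type*} [Category* A] [Abelian A] {V : Type*} [Category* V]
  [HasZeroObject V] [HasShift V ℤ] [Preadditive V] [∀ n : ℤ, (shiftFunctor V n).Additive]
  [Pretriangulated V]

lemma distTriang_mk (H : ExactRealization A V) {X Y Z : A} {i : X ⟶ Y} {p : Y ⟶ Z}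
    {w : i ≫ p = 0} (hS : (ShortComplex.mk i p w).ShortExact) :
    Triangle.mk (H.functor.map i) (H.functor.map p) (H.δ _ hS) ∈ distTriang V :=
  H.distinguished _ hS

/-- The composition of an exact realization and a triangulated functor. -/
noncomputable def comp (H : ExactRealization A V) {V' : Type*} [Category* V'] [HasZeroObject V']
    [HasShift V' ℤ] [Preadditive V'] [∀ n : ℤ, (shiftFunctor V' n).Additive] [Pretriangulated V']
    (F : V ⥤ V') [F.CommShift ℤ] [F.IsTriangulated] : ExactRealization A V' where
  functor := H.functor ⋙ F
  additive := inferInstance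
  δ S hS := F.map (H.δ S hS) ≫ (F.commShiftIso (1 : ℤ)).hom.app _
  δ_naturality S S' hS hS' φ := by
    have h₁ := F.congr_map (H.δ_naturality S S' hS hS' φ)
    have h₂ := (F.commShiftIso (1 : ℤ)).hom.naturality (H.functor.map φ.τ₁)
    simp only [Functor.map_comp, Functor.comp_map] at h₁ h₂ ⊢
    rw [Category.assoc, ← h₂, reassoc_of% h₁]
  distinguished S hS := F.map_distinguished _ (H.distinguished S hS)

/-- The conditions satisfied by the realization of a localization context `(D', E') ⟶ (D, E)` in
the corresponding homotopy category. -/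
structure IsAdapted (H : ExactRealization A V) (D' E' D E : ObjectProperty A) : Prop where
  isZero_left_iff : ∀ ⦃X : A⦄, D X → (IsZero (H.functor.obj X) ↔ D' X)
  isZero_right_iff : ∀ ⦃X : A⦄, E' X → (IsZero (H.functor.obj X) ↔ E X)
  map_surjective : ∀ ⦃X Y : A⦄, D X → E' Y →
    ∀ φ : H.functor.obj X ⟶ H.functor.obj Y, ∃ f : X ⟶ Y, H.functor.map f = φ
  exists_fac : ∀ ⦃X Y : A⦄, D X → E' Y → ∀ f : X ⟶ Y, H.functor.map f = 0 →
    ∃ (C : A) (a : X ⟶ C) (b : C ⟶ Y), D' C ∧ E' C ∧ a ≫ b = f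

end ExactRealization

variable (A : Type u) [Category.{v} A] [Abelian A] [HasDerivedCategory.{w'} A]

/-- The realization of an abelian category in its derived category. -/
noncomputable def derivedRealization : ExactRealization A (DerivedCategory A) where
  functor := DerivedCategory.singleFunctor A 0
  additive := inferInstance
  δ _ hS := hS.singleδ
  δ_naturality _ _ hS hS' φ := (ShortComplex.ShortExact.singleTriangle.map hS hS' φ).comm₃
  distinguished _ hS := hS.singleTriangle_distinguished

variable {A}

/-- The Verdier quotient of the derived category by the triangulated subcategory generated by
two classes of objects of the abelian category. -/
abbrev VerdierQuotient (Cw Fw : ObjectProperty A) :=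
  (trivialHull (DerivedCategory.singleFunctor A 0) Cw Fw).trW.Localization

/-- The localization functor from the derived category to the Verdier quotient. -/
noncomputable abbrev verdierQ (Cw Fw : ObjectProperty A) :
    DerivedCategory A ⥤ VerdierQuotient Cw Fw :=
  (trivialHull (DerivedCategory.singleFunctor A 0) Cw Fw).trW.Q

/-- The realization of an abelian category in a Verdier quotient of its derived category. -/
noncomputable def verdierRealization (Cw Fw : ObjectProperty A) :
    ExactRealization A (VerdierQuotient Cw Fw) :=
  (derivedRealization A).comp (verdierQ Cw Fw)

lemma isZero_verdierQ (Cw Fw : ObjectProperty A) {X : DerivedCategory A}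
    (hX : trivialHull (DerivedCategory.singleFunctor A 0) Cw Fw X) :
    IsZero ((verdierQ Cw Fw).obj X) := by
  have := Localization.inverts (verdierQ Cw Fw)
    (trivialHull (DerivedCategory.singleFunctor A 0) Cw Fw).trW _
    (ObjectProperty.trW.mk _ (inv_rot_of_distTriang _ (contractible_distinguished X)) hX)
  exact IsZero.of_iso ((verdierQ Cw Fw).map_isZero
    ((shiftFunctor _ (-1 : ℤ)).map_isZero (isZero_zero _)))
    (@asIso _ _ _ _ _ this).symm

namespace IsLocalizationContext

open DerivedCategory

variable [HasExt.{w} A] {D' E' D E : ObjectProperty A} (h : IsLocalizationContext.{w} D' E' D E)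
include h

/-- In the quotient `Y` becomes isomorphic to `Y'⟦1⟧`. This moves morphisms into `Y` to the range `k
≥ 1`, where they are computed in the derived category. -/
lemma exists_distTriang {Y : A} (hY : E' Y) :
    ∃ (Y' P : A) (i : Y' ⟶ P) (p : P ⟶ Y)
      (d : (singleFunctor A 0).obj Y ⟶ ((singleFunctor A 0).obj Y')⟦(1 : ℤ)⟧),
      Triangle.mk ((singleFunctor A 0).map i) ((singleFunctor A 0).map p) d ∈
        distTriang (DerivedCategory A) ∧ E' Y' ∧ D' P ∧ E' P ∧
        IsIso ((verdierQ D' E).map d) := by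
  obtain ⟨Y', P, i, p, w, hS, hY', hP⟩ := h.source.complete.enough_projectives Y
  refine ⟨Y', P, i, p, _, distTriang_single hS, hY', hP,
    h.source.cotorsion.right_ext hS hY' hY, ?_⟩
  exact Localization.inverts (verdierQ D' E) (trivialHull (singleFunctor A 0) D' E).trW _
    (ObjectProperty.trW.mk _ (rot_of_distTriang _ (rot_of_distTriang _ (distTriang_single hS)))
      (.shift _ 1 (trivialHull_left _ hP)))

theorem isAdapted_verdierRealization :
    (verdierRealization D' E).IsAdapted D' E' D E where
  isZero_left_iff X hX := by
    refine ⟨fun h₀ => h.source.cotorsion.left_of_forall fun Y hY f => ?_,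
      fun h₀ => isZero_verdierQ D' E (trivialHull_left _ h₀)⟩
    exact h.perpResolutions.map_injective (verdierQ D' E) (h.target.leftPerp hX) hY le_rfl
      (h₀.eq_of_src _ _)
  isZero_right_iff Y hY := by
    refine ⟨fun h₀ => h.target.cotorsion.right_of_forall fun X hX f => ?_,
      fun h₀ => isZero_verdierQ D' E (trivialHull_right _ h₀)⟩
    have h₁ : IsZero ((verdierQ D' E).obj (((singleFunctor A 0).obj Y)⟦(1 : ℤ)⟧)) :=
      IsZero.of_iso ((shiftFunctor _ (1 : ℤ)).map_isZero h₀)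
        (((verdierQ D' E).commShiftIso (1 : ℤ)).app _)
    exact h.perpResolutions.map_injective (verdierQ D' E) (h.target.leftPerp hX) hY le_rfl
      (h₁.eq_of_tgt _ _)
  map_surjective X Y hX hY φ := by
    obtain ⟨Y', P, i, p, d, hT, hY', hP, hP', hd⟩ := h.exists_distTriang hY
    obtain ⟨t, ht⟩ := h.perpResolutions.map_surjective (verdierQ D' E) (h.target.leftPerp hX) hY'
      le_rfl (φ ≫ (verdierQ D' E).map d)
    -- The obstruction to lifting `t` through `d` is in Ext¹(X, P), which vanishes because the core
    -- object `P` lies in `E`.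
    obtain ⟨f, hf⟩ := exists_lift_of_distTriang (rot_of_distTriang _ (rot_of_distTriang _ hT)) t
      (h.target.leftPerp hX (h.right_of_core hP hP') 1 le_rfl _)
    obtain ⟨f, rfl⟩ := (singleFunctor A 0).map_surjective f
    refine ⟨f, (cancel_mono ((verdierQ D' E).map d)).1 (Eq.trans ?_ ht)⟩
    rw [hf]
    exact ((verdierQ D' E).map_comp _ _).symm
  exists_fac X Y hX hY f hf := by
    obtain ⟨Y', P, i, p, d, hT, hY', hP, hP', hd⟩ := h.exists_distTriang hY
    obtain ⟨a, ha⟩ := exists_lift_of_comp_eq_zero hT ((singleFunctor A 0).map f)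
      (h.perpResolutions.map_injective (verdierQ D' E) (h.target.leftPerp hX) hY' le_rfl (by
        replace hf : (verdierQ D' E).map ((singleFunctor A 0).map f) = 0 := hf
        rw [Functor.map_comp, hf, zero_comp, Functor.map_zero]))
    obtain ⟨a, rfl⟩ := (singleFunctor A 0).map_surjective a
    exact ⟨P, a, p, hP, hP', (singleFunctor A 0).map_injective (by simpa using ha.symm)⟩

end IsLocalizationContext

end Realization

/-! ### Existence and uniqueness of the abelian model structures -/

section ModelStructure

variable {A : Type u} [Category.{v} A] [Abelian A]

namespace AbelianModelStructure

lemma IsTriple.cof_eq {M : AbelianModelStructure A} {C F : ObjectProperty A}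
    (hM : M.IsTriple C F) : M.Cof = monoWithCokernel C := by
  obtain ⟨rfl, rfl⟩ := hM
  ext X Y f
  exact M.cofibrations_iff f

lemma IsTriple.fib_eq {M : AbelianModelStructure A} {C F : ObjectProperty A}
    (hM : M.IsTriple C F) : M.Fib = epiWithKernel F := by
  obtain ⟨rfl, rfl⟩ := hM
  ext X Y f
  exact M.fibrations_iff f

/-- A weak equivalence is a trivial cofibration followed by a trivial fibration, and lifting
properties determine both classes. Hence cofibrations and fibrations determine the model structure.
-/
lemma W_eq_of_cof_fib (M : AbelianModelStructure A) {X Y : A} (f : X ⟶ Y) :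
    M.W f ↔ ∃ (Z : A) (i : X ⟶ Z) (p : Z ⟶ Y), i ≫ p = f ∧ M.Fib.llp i ∧ M.Cof.rlp p := by
  let := M.model
  have h₁ : M.Fib.llp = trivialCofibrations A :=
    MorphismProperty.llp_eq_of_wfs (trivialCofibrations A) (fibrations A)
  have h₂ : M.Cof.rlp = trivialFibrations A :=
    MorphismProperty.rlp_eq_of_wfs (cofibrations A) (trivialFibrations A)
  rw [h₁, h₂]
  constructor
  · intro hf
    let φ := MorphismProperty.factorizationData (trivialCofibrations A) (fibrations A) f
    refine ⟨_, φ.i, φ.p, φ.fac, φ.hi, φ.hp, ?_⟩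
    refine (weakEquivalences A).of_precomp φ.i φ.p φ.hi.2 ?_
    rw [φ.fac]
    exact hf
  · rintro ⟨Z, i, p, rfl, hi, hp⟩
    exact (weakEquivalences A).comp_mem _ _ hi.2 hp.2

lemma ext_of_cof_fib {M N : AbelianModelStructure A} (h : M.Cof = N.Cof) (h' : M.Fib = N.Fib) :
    M = N := by
  have h'' : M.W = N.W := by
    ext X Y f
    rw [W_eq_of_cof_fib, W_eq_of_cof_fib, h, h']
  obtain ⟨⟨⟨m₁⟩, ⟨m₂⟩, ⟨m₃⟩⟩, _, _⟩ := M
  obtain ⟨⟨⟨n₁⟩, ⟨n₂⟩, ⟨n₃⟩⟩, _, _⟩ := N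
  obtain rfl : m₂ = n₂ := h
  obtain rfl : m₁ = n₁ := h'
  obtain rfl : m₃ = n₃ := h''
  rfl

lemma IsTriple.eq {M N : AbelianModelStructure A} {C F : ObjectProperty A}
    (hM : M.IsTriple C F) (hN : N.IsTriple C F) : M = N :=
  ext_of_cof_fib (hM.cof_eq.trans hN.cof_eq.symm) (hM.fib_eq.trans hN.fib_eq.symm)

end AbelianModelStructure

variable {V : Type*} [Category* V]
  [HasZeroObject V] [HasShift V ℤ] [Preadditive V] [∀ n : ℤ, (shiftFunctor V n).Additive]
  [Pretriangulated V]

namespace ExactRealization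

variable (H : ExactRealization A V)

/-- The morphisms which are inverted by an exact realization. -/
def inverted : MorphismProperty A :=
  (MorphismProperty.isomorphisms V).inverseImage H.functor

lemma isIso_map_iff_of_mono {X Y Z : A} {i : X ⟶ Y} {p : Y ⟶ Z} {w : i ≫ p = 0}
    (hS : (ShortComplex.mk i p w).ShortExact) :
    H.inverted i ↔ IsZero (H.functor.obj Z) :=
  (Triangle.isZero₃_iff_isIso₁ _ (H.distTriang_mk hS)).symm

lemma isIso_map_iff_of_epi {X Y Z : A} {i : X ⟶ Y} {p : Y ⟶ Z} {w : i ≫ p = 0}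
    (hS : (ShortComplex.mk i p w).ShortExact) :
    H.inverted p ↔ IsZero (H.functor.obj X) :=
  (Triangle.isZero₁_iff_isIso₂ _ (H.distTriang_mk hS)).symm

instance : H.inverted.HasTwoOutOfThreeProperty := by
  dsimp [inverted]
  infer_instance

variable {H} {D' E' D E : ObjectProperty A}

lemma IsAdapted.monoWithCokernel_inf (hH : H.IsAdapted D' E' D E) (hD : D' ≤ D) :
    monoWithCokernel D ⊓ H.inverted = monoWithCokernel D' := by
  ext X Y f
  constructor
  · rintro ⟨⟨_, h⟩, hf⟩
    exact ⟨inferInstance, (hH.isZero_left_iff h).1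
      ((H.isIso_map_iff_of_mono (shortExact_cokernel f)).1 hf)⟩
  · rintro ⟨_, h⟩
    exact ⟨⟨inferInstance, hD _ h⟩, (H.isIso_map_iff_of_mono (shortExact_cokernel f)).2
      ((hH.isZero_left_iff (hD _ h)).2 h)⟩

lemma IsAdapted.epiWithKernel_inf (hH : H.IsAdapted D' E' D E) (hE : E ≤ E') :
    epiWithKernel E' ⊓ H.inverted = epiWithKernel E := by
  ext X Y f
  constructor
  · rintro ⟨⟨_, h⟩, hf⟩
    exact ⟨inferInstance, (hH.isZero_right_iff h).1
      ((H.isIso_map_iff_of_epi (shortExact_kernel f)).1 hf)⟩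
  · rintro ⟨_, h⟩
    exact ⟨⟨inferInstance, hE _ h⟩, (H.isIso_map_iff_of_epi (shortExact_kernel f)).2
      ((hH.isZero_right_iff (hE _ h)).2 h)⟩

end ExactRealization

variable [HasExt.{w} A] [HasDerivedCategory.{w'} A] {D' E' D E : ObjectProperty A}

namespace IsLocalizationContext

theorem exists_abelianModelStructure {H : ExactRealization A V}
    (h : IsLocalizationContext.{w} D' E' D E) (hH : H.IsAdapted D' E' D E) :
    ∃ M : AbelianModelStructure A, M.IsTriple D E' ∧ M.W = H.inverted := by
  let : CategoryWithCofibrations A := ⟨monoWithCokernel D⟩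
  let : CategoryWithFibrations A := ⟨epiWithKernel E'⟩
  let : CategoryWithWeakEquivalences A := ⟨H.inverted⟩
  have : (weakEquivalences A).HasTwoOutOfThreeProperty :=
    inferInstanceAs H.inverted.HasTwoOutOfThreeProperty
  have : MorphismProperty.IsWeakFactorizationSystem (cofibrations A) (trivialFibrations A) := by
    have h₁ : trivialFibrations A = epiWithKernel E := hH.epiWithKernel_inf h.right_le
    rw [h₁]
    exact h.target.cotorsion.isWeakFactorizationSystem h.target.complete
  have : MorphismProperty.IsWeakFactorizationSystem (trivialCofibrations A) (fibrations A) := by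
    have h₁ : trivialCofibrations A = monoWithCokernel D' := hH.monoWithCokernel_inf h.le
    rw [h₁]
    exact h.source.cotorsion.isWeakFactorizationSystem h.source.complete
  have := h.target.cotorsion.left_isClosedUnderIsomorphisms
  have := h.source.cotorsion.right_isClosedUnderIsomorphisms
  have hc (X : A) : IsCofibrant X ↔ D X := (cofibration_iff _).trans
    (monoWithCokernel_zero_iff D (IsZero.of_iso (isZero_zero A) HasZeroObject.zeroIsoInitial.symm) _)
  have hf (X : A) : IsFibrant X ↔ E' X := (fibration_iff _).trans
    (epiWithKernel_zero_iff E' (IsZero.of_iso (isZero_zero A) HasZeroObject.zeroIsoTerminal.symm) _)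
  exact ⟨
    { model := ModelCategory.mk' A
      cofibrations_iff X Y f := and_congr_right fun _ => (hc _).symm
      fibrations_iff X Y f := and_congr_right fun _ => (hf _).symm },
    ⟨funext fun X => propext (hc X), funext fun X => propext (hf X)⟩, rfl⟩

lemma existsUnique_abelianModelStructure (h : IsLocalizationContext.{w} D' E' D E) :
    ∃! M : AbelianModelStructure A, M.IsTriple D E' := by
  obtain ⟨M, hM, -⟩ := h.exists_abelianModelStructure h.isAdapted_verdierRealization
  exact ⟨M, hM, fun N hN => hN.eq hM⟩

lemma W_eq {H : ExactRealization A V} (h : IsLocalizationContext.{w} D' E' D E)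
    (hH : H.IsAdapted D' E' D E) {M : AbelianModelStructure A} (hM : M.IsTriple D E') :
    M.W = H.inverted := by
  obtain ⟨N, hN, hW⟩ := h.exists_abelianModelStructure hH
  rw [hM.eq hN, hW]

end IsLocalizationContext

omit [HasExt.{w} A] [HasDerivedCategory.{w'} A] in
lemma AbelianModelStructure.isIdentityQuillenAdjunction {M N : AbelianModelStructure A}
    {C F C' F' : ObjectProperty A} (hM : M.IsTriple C F) (hN : N.IsTriple C' F')
    (hC : C ≤ C') (hF : F' ≤ F) : M.IsIdentityQuillenAdjunction N where
  cof_le := by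
    rw [hM.cof_eq, hN.cof_eq]
    exact fun _ _ _ h => ⟨h.1, hC _ h.2⟩
  fib_le := by
    rw [hM.fib_eq, hN.fib_eq]
    exact fun _ _ _ h => ⟨h.1, hF _ h.2⟩

end ModelStructure

/-! ### Transfer of a triangulated structure along a fully faithful functor -/

section Transfer

variable {T V : Type*} [Category* T] [Category* V] (G : T ⥤ V) [G.Full] [G.Faithful]
  [HasShift V ℤ]

lemma exists_shift_of_fully_faithful
    (hG : ∀ (X : T), G.essImage ((G.obj X)⟦(1 : ℤ)⟧) ∧ G.essImage ((G.obj X)⟦(-1 : ℤ)⟧)) :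
    ∃ (_ : HasShift T ℤ), Nonempty (G.CommShift ℤ) := by
  have h₁ {X : V} (hX : G.essImage X) : G.essImage (X⟦(1 : ℤ)⟧) := by
    obtain ⟨Y, ⟨e⟩⟩ := hX
    exact ObjectProperty.prop_of_iso _ ((shiftFunctor V (1 : ℤ)).mapIso e) (hG Y).1
  have h₂ {X : V} (hX : G.essImage X) : G.essImage (X⟦(-1 : ℤ)⟧) := by
    obtain ⟨Y, ⟨e⟩⟩ := hX
    exact ObjectProperty.prop_of_iso _ ((shiftFunctor V (-1 : ℤ)).mapIso e) (hG Y).2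
  have h (n : ℤ) (X : T) : G.essImage ((G ⋙ shiftFunctor V n).obj X) := by
    dsimp
    induction n with
    | zero =>
      exact ObjectProperty.prop_of_iso _ ((shiftFunctorZero V ℤ).symm.app _) (G.obj_mem_essImage X)
    | succ n ih =>
      exact ObjectProperty.prop_of_iso _
        ((shiftFunctorAdd' V (n : ℤ) 1 (n + 1) rfl).symm.app _) (h₁ ih)
    | pred n ih =>
      exact ObjectProperty.prop_of_iso _
        ((shiftFunctorAdd' V (-n : ℤ) (-1) (-n - 1) rfl).symm.app _) (h₂ ih)
  exact ⟨(Functor.FullyFaithful.ofFullyFaithful G).hasShift _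
    (fun n => Functor.essImage.liftFunctorCompIso (G ⋙ shiftFunctor V n) G (h n)),
    ⟨Functor.CommShift.ofHasShiftOfFullyFaithful _ _ _⟩⟩

/-- Constructor for isomorphisms between triangles given by their morphisms. -/
def triangleMkIso {X Y Z X' Y' Z' : V} {f : X ⟶ Y} {g : Y ⟶ Z} {d : Z ⟶ X⟦(1 : ℤ)⟧}
    {f' : X' ⟶ Y'} {g' : Y' ⟶ Z'} {d' : Z' ⟶ X'⟦(1 : ℤ)⟧} (a : X ≅ X') (b : Y ≅ Y') (c : Z ≅ Z')
    (h₁ : f ≫ b.hom = a.hom ≫ f') (h₂ : g ≫ c.hom = b.hom ≫ g')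
    (h₃ : d ≫ a.hom⟦(1 : ℤ)⟧' = c.hom ≫ d') : Triangle.mk f g d ≅ Triangle.mk f' g' d' :=
  Triangle.isoMk _ _ a b c h₁ h₂ h₃

variable [HasZeroObject V] [Preadditive V] [∀ n : ℤ, (shiftFunctor V n).Additive]
  [Pretriangulated V] [Preadditive T] [HasShift T ℤ] [HasZeroObject T]
  [∀ n : ℤ, (shiftFunctor T n).Additive] [G.CommShift ℤ] [G.Additive]

/-- The pretriangulated structure induced by a fully faithful functor to a pretriangulated
category whose image is closed under cones. -/
@[reducible]
noncomputable def pretriangulatedOfFullyFaithful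
    (hG : ∀ ⦃X Y : T⦄ (f : X ⟶ Y), ∃ (Z : T) (g : G.obj Y ⟶ G.obj Z)
      (h : G.obj Z ⟶ (G.obj X)⟦(1 : ℤ)⟧), Triangle.mk (G.map f) g h ∈ distTriang V) :
    Pretriangulated T where
  distinguishedTriangles := G.mapTriangle.obj ⁻¹' (distTriang V)
  isomorphic_distinguished T₁ hT₁ T₂ e :=
    isomorphic_distinguished _ hT₁ _ (G.mapTriangle.mapIso e)
  contractible_distinguished X :=
    isomorphic_distinguished _ (contractible_distinguished (G.obj X)) _
      (triangleMkIso (f := G.map (𝟙 X)) (g := G.map 0)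
        (d := G.map 0 ≫ (G.commShiftIso (1 : ℤ)).hom.app X) (Iso.refl _) (Iso.refl _)
        G.mapZeroObject (by simp)
        (by rw [G.map_zero]; exact zero_comp.trans comp_zero.symm)
        (by rw [G.map_zero, zero_comp]; exact zero_comp.trans comp_zero.symm))
  distinguished_cocone_triangle {X Y} f := by
    obtain ⟨Z, g, h, mem⟩ := hG f
    exact ⟨Z, G.preimage g, G.preimage (h ≫ (G.commShiftIso (1 : ℤ)).inv.app X),
      isomorphic_distinguished _ mem _ (triangleMkIso (f := G.map f)
        (g := G.map (G.preimage g))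
        (d := G.map (G.preimage (h ≫ (G.commShiftIso (1 : ℤ)).inv.app X)) ≫
          (G.commShiftIso (1 : ℤ)).hom.app X) (Iso.refl _) (Iso.refl _) (Iso.refl _)
        (by simp) (by simp) (by simp))⟩
  rotate_distinguished_triangle T :=
    (rotate_distinguished_triangle (G.mapTriangle.obj T)).trans
      (distinguished_iff_of_iso (G.mapTriangleRotateIso.app T))
  complete_distinguished_triangle_morphism T₁ T₂ hT₁ hT₂ a b comm := by
    obtain ⟨c, hc₁, hc₂⟩ : ∃ c : G.obj T₁.obj₃ ⟶ G.obj T₂.obj₃,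
        G.map T₁.mor₂ ≫ c = G.map b ≫ G.map T₂.mor₂ ∧
          (G.map T₁.mor₃ ≫ (G.commShiftIso (1 : ℤ)).hom.app T₁.obj₁) ≫ (G.map a)⟦(1 : ℤ)⟧' =
            c ≫ G.map T₂.mor₃ ≫ (G.commShiftIso (1 : ℤ)).hom.app T₂.obj₁ :=
      complete_distinguished_triangle_morphism (G.mapTriangle.obj T₁) (G.mapTriangle.obj T₂)
        hT₁ hT₂ (G.map a) (G.map b) (by
          simpa only [Functor.map_comp] using! G.congr_map comm)
    refine ⟨G.preimage c, ⟨G.map_injective (by simpa using hc₁), G.map_injective ?_⟩⟩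
    have := G.commShiftIso_hom_naturality a (1 : ℤ)
    rw [← cancel_mono ((G.commShiftIso (1 : ℤ)).hom.app T₂.obj₁)]
    simpa [this] using hc₂

end Transfer

/-! ### The homotopy category inside the triangulated realization -/

section HomotopyCategory

variable {A : Type u} [Category.{v} A] [Abelian A]

namespace AbelianModelStructure

lemma IsTriple.map_surjective {M : AbelianModelStructure A} {C F : ObjectProperty A}
    (hM : M.IsTriple C F) {X Y : A} (hX : C X) (hY : F Y) (φ : M.Q.obj X ⟶ M.Q.obj Y) :
    ∃ f : X ⟶ Y, M.Q.map f = φ := by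
  let := M.model
  have : IsCofibrant X := by
    rw [← hM.cofibrant_eq] at hX
    exact hX
  have : IsFibrant Y := by
    rw [← hM.fibrant_eq] at hY
    exact hY
  have : M.Q.IsLocalization (weakEquivalences A) :=
    inferInstanceAs (M.W.Q.IsLocalization M.W)
  exact HomotopicalAlgebra.map_surjective_of_isLocalization M.Q X Y φ

end AbelianModelStructure

variable {V : Type*} [Category* V]
  [HasZeroObject V] [HasShift V ℤ] [Preadditive V] [∀ n : ℤ, (shiftFunctor V n).Additive]
  [Pretriangulated V] {H : ExactRealization A V} [HasExt.{w} A] [HasDerivedCategory.{w'} A]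
  {D' E' D E : ObjectProperty A} (h : IsLocalizationContext.{w} D' E' D E)
  (hH : H.IsAdapted D' E' D E)

section

include h

lemma IsLocalizationContext.exists_fibrant_replacement (X : A) :
    ∃ (Y : A) (i : X ⟶ Y), monoWithCokernel D' i ∧ E' Y ∧ (D X → D Y) := by
  obtain ⟨Y, Z, i, p, w, hS, hY, hZ⟩ := h.source.complete.enough_injectives X
  have := h.source.cotorsion.left_isClosedUnderIsomorphisms
  exact ⟨Y, i, (monoWithCokernel_iff D' hS).2 hZ, hY,
    fun hX => h.target.cotorsion.left_ext hS hX (h.le _ hZ)⟩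

lemma IsLocalizationContext.exists_cofibrant_replacement (X : A) :
    ∃ (Y : A) (p : Y ⟶ X), epiWithKernel E p ∧ D Y ∧ (E' X → E' Y) := by
  obtain ⟨Z, Y, i, p, w, hS, hZ, hY⟩ := h.target.complete.enough_projectives X
  have := h.target.cotorsion.right_isClosedUnderIsomorphisms
  exact ⟨Y, p, (epiWithKernel_iff E hS).2 hZ, hY,
    fun hX => h.source.cotorsion.right_ext hS (h.right_le _ hZ) hX⟩

end

namespace ExactRealization.IsAdapted

include h hH

omit [HasDerivedCategory.{w'} A] in
lemma inverted_of_mono {X Y : A} {i : X ⟶ Y} (hi : monoWithCokernel D' i) : H.inverted i := by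
  rw [← hH.monoWithCokernel_inf h.le] at hi
  exact hi.2

lemma inverted_of_epi {X Y : A} {p : X ⟶ Y} (hp : epiWithKernel E p) : H.inverted p := by
  rw [← hH.epiWithKernel_inf h.right_le] at hp
  exact hp.2

variable {M : AbelianModelStructure A} (hM : M.IsTriple D E')

include hM

lemma isIso_Q_map {X Y : A} {f : X ⟶ Y} (hf : H.inverted f) : IsIso (M.Q.map f) := by
  rw [← h.W_eq hH hM] at hf
  exact Localization.inverts M.Q M.W f hf

lemma exists_iso_Q_obj_left (X : A) :
    ∃ Y : A, D Y ∧ (E' X → E' Y) ∧ Nonempty (M.Q.obj Y ≅ M.Q.obj X) := by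
  obtain ⟨Y, p, hp, hY, hY'⟩ := h.exists_cofibrant_replacement X
  have := hH.isIso_Q_map h hM (hH.inverted_of_epi h hp)
  exact ⟨Y, hY, hY', ⟨asIso (M.Q.map p)⟩⟩

lemma exists_iso_Q_obj_right (X : A) :
    ∃ Y : A, E' Y ∧ (D X → D Y) ∧ Nonempty (M.Q.obj Y ≅ M.Q.obj X) := by
  obtain ⟨Y, i, hi, hY, hY'⟩ := h.exists_fibrant_replacement X
  have := hH.isIso_Q_map h hM (hH.inverted_of_mono h hi)
  exact ⟨Y, hY, hY', ⟨(asIso (M.Q.map i)).symm⟩⟩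

omit h hH hM [HasExt.{w} A] [HasDerivedCategory.{w'} A] in
lemma exists_Q_obj_iso (X : M.Ho) : ∃ X₀ : A, Nonempty (M.Q.obj X₀ ≅ X) := by
  have := Localization.essSurj M.Q M.W
  exact ⟨_, ⟨M.Q.objObjPreimageIso X⟩⟩

lemma exists_iso_left (X : M.Ho) : ∃ X₀ : A, D X₀ ∧ Nonempty (M.Q.obj X₀ ≅ X) := by
  obtain ⟨X₁, ⟨e⟩⟩ := exists_Q_obj_iso X
  obtain ⟨X₀, h₀, -, ⟨e'⟩⟩ := hH.exists_iso_Q_obj_left h hM X₁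
  exact ⟨X₀, h₀, ⟨e' ≪≫ e⟩⟩

lemma exists_iso_right (X : M.Ho) : ∃ X₀ : A, E' X₀ ∧ Nonempty (M.Q.obj X₀ ≅ X) := by
  obtain ⟨X₁, ⟨e⟩⟩ := exists_Q_obj_iso X
  obtain ⟨X₀, h₀, -, ⟨e'⟩⟩ := hH.exists_iso_Q_obj_right h hM X₁
  exact ⟨X₀, h₀, ⟨e' ≪≫ e⟩⟩

/-- The inclusion `Y ⟶ Y ⊞ C` is a trivial cofibration, so the two maps `Y ⊞ C ⟶ Y` given by `(𝟙,
b)` and `(𝟙, 0)`, which agree on `Y`, become equal. No additive structure on the homotopy category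
is needed. -/
lemma Q_map_eq_of_sub_eq {X Y C : A} {f g : X ⟶ Y} {a : X ⟶ C} {b : C ⟶ Y} (hC : D' C)
    (hab : f = g + a ≫ b) : M.Q.map f = M.Q.map g := by
  have := h.source.cotorsion.left_isClosedUnderIsomorphisms
  have := hH.isIso_Q_map h hM (hH.inverted_of_mono h
    ((monoWithCokernel_iff D' (shortExact_biprod Y C)).2 hC))
  have h₁ : M.Q.map (biprod.desc (𝟙 Y) b) = M.Q.map (biprod.desc (𝟙 Y) 0) := by
    rw [← cancel_epi (M.Q.map (biprod.inl : Y ⟶ Y ⊞ C)), ← M.Q.map_comp, ← M.Q.map_comp]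
    simp
  have h₂ : f = biprod.lift g a ≫ biprod.desc (𝟙 Y) b := by simp [hab]
  have h₃ : g = biprod.lift g a ≫ biprod.desc (𝟙 Y) 0 := by simp
  rw [h₂, M.Q.map_comp, h₁, ← M.Q.map_comp, ← h₃]

lemma Q_map_eq {X Y : A} (hX : D X) (hY : E' Y) {f g : X ⟶ Y}
    (hfg : H.functor.map f = H.functor.map g) : M.Q.map f = M.Q.map g := by
  obtain ⟨C, a, b, hC, -, hab⟩ := hH.exists_fac hX hY (f - g) (by
    rw [Functor.map_sub, hfg, sub_self])
  exact hH.Q_map_eq_of_sub_eq h hM hC (sub_eq_iff_eq_add'.1 hab.symm)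

lemma inverts : M.W.IsInvertedBy H.functor := by
  rw [h.W_eq hH hM]
  exact fun _ _ _ hf => hf

variable {G : M.Ho ⥤ V} (e : M.Q ⋙ G ≅ H.functor)

include e

lemma full : G.Full where
  map_surjective {X Y} φ := by
    obtain ⟨X₀, hX, ⟨eX⟩⟩ := hH.exists_iso_left h hM X
    obtain ⟨Y₀, hY, ⟨eY⟩⟩ := hH.exists_iso_right h hM Y
    obtain ⟨f, hf⟩ := hH.map_surjective hX hY
      (e.inv.app X₀ ≫ G.map eX.hom ≫ φ ≫ G.map eY.inv ≫ e.hom.app Y₀)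
    refine ⟨eX.inv ≫ M.Q.map f ≫ eY.hom, ?_⟩
    have h₁ : G.map (M.Q.map f) = G.map eX.hom ≫ φ ≫ G.map eY.inv := by
      rw [← cancel_mono (e.hom.app Y₀), ← cancel_epi (e.inv.app X₀)]
      simpa [hf] using e.inv.app X₀ ≫= e.hom.naturality f
    rw [G.map_comp, G.map_comp, h₁]
    simp

lemma faithful : G.Faithful where
  map_injective {X Y φ ψ} hφψ := by
    obtain ⟨X₀, hX, ⟨eX⟩⟩ := hH.exists_iso_left h hM X
    obtain ⟨Y₀, hY, ⟨eY⟩⟩ := hH.exists_iso_right h hM Y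
    obtain ⟨f, hf⟩ := hM.map_surjective hX hY (eX.hom ≫ φ ≫ eY.inv)
    obtain ⟨g, hg⟩ := hM.map_surjective hX hY (eX.hom ≫ ψ ≫ eY.inv)
    have h₁ : H.functor.map f = H.functor.map g := by
      rw [← NatIso.naturality_1 e f, ← NatIso.naturality_1 e g]
      simp [hf, hg, hφψ]
    have h₂ := hH.Q_map_eq h hM hX hY h₁
    rw [hf, hg] at h₂
    simpa using h₂

omit hM e in
lemma exists_shortExact_isZero_middle (X : A) :
    ∃ (J Z : A) (i : X ⟶ J) (p : J ⟶ Z) (w : i ≫ p = 0),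
      (ShortComplex.mk i p w).ShortExact ∧ IsZero (H.functor.obj J) := by
  obtain ⟨J, Z, i, p, w, hS, hJ, -⟩ := h.target.complete.enough_injectives X
  exact ⟨J, Z, i, p, w, hS, (hH.isZero_right_iff (h.right_le _ hJ)).2 hJ⟩

omit hM e [HasDerivedCategory.{w'} A] in
lemma exists_shortExact_isZero_middle' (X : A) :
    ∃ (K P : A) (i : K ⟶ P) (p : P ⟶ X) (w : i ≫ p = 0),
      (ShortComplex.mk i p w).ShortExact ∧ IsZero (H.functor.obj P) := by
  obtain ⟨K, P, i, p, w, hS, -, hP⟩ := h.source.complete.enough_projectives X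
  exact ⟨K, P, i, p, w, hS, (hH.isZero_left_iff (h.le _ hP)).2 hP⟩

omit hM in
-- The suspension of `X₀` is represented by its cokernel in an object of `E`, and the desuspension
-- by the kernel of an epimorphism from an object of `D'`; both middle terms vanish in `V`.
lemma essImage_shift (X : M.Ho) :
    G.essImage ((G.obj X)⟦(1 : ℤ)⟧) ∧ G.essImage ((G.obj X)⟦(-1 : ℤ)⟧) := by
  obtain ⟨X₀, ⟨eX⟩⟩ := exists_Q_obj_iso X
  let eX' : H.functor.obj X₀ ≅ G.obj X := (e.app X₀).symm ≪≫ G.mapIso eX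
  constructor
  · obtain ⟨J, Z, i, p, w, hS, hJ⟩ := hH.exists_shortExact_isZero_middle h X₀
    have : IsIso (H.δ _ hS) := (Triangle.isZero₂_iff_isIso₃ _ (H.distTriang_mk hS)).1 hJ
    exact ⟨M.Q.obj Z, ⟨e.app Z ≪≫ asIso (H.δ _ hS) ≪≫ (shiftFunctor V (1 : ℤ)).mapIso eX'⟩⟩
  · obtain ⟨K, P, i, p, w, hS, hP⟩ := hH.exists_shortExact_isZero_middle' h X₀
    have : IsIso (H.δ _ hS) := (Triangle.isZero₂_iff_isIso₃ _ (H.distTriang_mk hS)).1 hP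
    exact ⟨M.Q.obj K, ⟨e.app K ≪≫ (shiftFunctorCompIsoId V (1 : ℤ) (-1) (by simp)).symm.app _ ≪≫
      (shiftFunctor V (-1 : ℤ)).mapIso ((asIso (H.δ _ hS)).symm ≪≫ eX')⟩⟩

omit e in
-- After replacing source and target, the arrow comes from some `f₀` in `A`. Adding to its target an
-- object `J` of `E` into which the source embeds makes it a monomorphism without changing it in the
-- homotopy category.
lemma exists_arrow_iso {X Y : M.Ho} (f : X ⟶ Y) :
    ∃ (X₀ Y₀ Z₀ : A) (i : X₀ ⟶ Y₀) (p : Y₀ ⟶ Z₀) (w : i ≫ p = 0)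
      (_ : (ShortComplex.mk i p w).ShortExact) (eX : X ≅ M.Q.obj X₀) (eY : Y ≅ M.Q.obj Y₀),
      f ≫ eY.hom = eX.hom ≫ M.Q.map i := by
  obtain ⟨X₀, hX, ⟨eX⟩⟩ := hH.exists_iso_left h hM X
  obtain ⟨Y₀, hY, ⟨eY⟩⟩ := hH.exists_iso_right h hM Y
  obtain ⟨f₀, hf₀⟩ := hM.map_surjective hX hY (eX.hom ≫ f ≫ eY.inv)
  obtain ⟨J, Z, j, p, w, hS, hJ, -⟩ := h.target.complete.enough_injectives X₀
  have : Mono j := hS.mono_f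
  have : Mono (biprod.lift j f₀) := mono_of_mono_fac (biprod.lift_fst j f₀)
  have := h.target.cotorsion.right_isClosedUnderIsomorphisms
  have := hH.isIso_Q_map h hM (hH.inverted_of_epi h
    ((epiWithKernel_iff E (shortExact_biprod J Y₀)).2 hJ))
  refine ⟨X₀, J ⊞ Y₀, _, biprod.lift j f₀, _, _, shortExact_cokernel _, eX.symm,
    eY.symm ≪≫ (asIso (M.Q.map (biprod.snd : J ⊞ Y₀ ⟶ Y₀))).symm, ?_⟩
  have h₁ : M.Q.map (biprod.lift j f₀) ≫ M.Q.map biprod.snd = M.Q.map f₀ := by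
    rw [← M.Q.map_comp, biprod.lift_snd]
  rw [hf₀] at h₁
  dsimp
  rw [← Category.assoc, IsIso.comp_inv_eq, Category.assoc, h₁, Iso.inv_hom_id_assoc]

end ExactRealization.IsAdapted

end HomotopyCategory

/-! ### The canonical triangulation -/

section CanonicalTriangulation

open ZeroObject

variable {A : Type u} [Category.{v} A] [Abelian A] {V : Type*} [Category* V]
  [HasZeroObject V] [HasShift V ℤ] [Preadditive V] [∀ n : ℤ, (shiftFunctor V n).Additive]
  [Pretriangulated V]

section

variable (H : ExactRealization A V) {T : Type*} [Category* T] {L : A ⥤ T} {G : T ⥤ V}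
  (e : L ⋙ G ≅ H.functor) [HasShift T ℤ] [G.CommShift ℤ] [G.Full]

/-- The connecting morphism obtained from an exact realization by means of a factorization
through a fully faithful functor. -/
noncomputable def liftδ (S : ShortComplex A) (hS : S.ShortExact) :
    L.obj S.X₃ ⟶ (L.obj S.X₁)⟦(1 : ℤ)⟧ :=
  G.preimage (e.hom.app S.X₃ ≫ H.δ S hS ≫ (e.inv.app S.X₁)⟦(1 : ℤ)⟧' ≫
    (G.commShiftIso (1 : ℤ)).inv.app _)

@[simp]
lemma map_liftδ (S : ShortComplex A) (hS : S.ShortExact) :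
    G.map (liftδ H e S hS) = e.hom.app S.X₃ ≫ H.δ S hS ≫ (e.inv.app S.X₁)⟦(1 : ℤ)⟧' ≫
      (G.commShiftIso (1 : ℤ)).inv.app _ := by
  simp [liftδ]

lemma liftδ_naturality [G.Faithful] (S S' : ShortComplex A) (hS : S.ShortExact)
    (hS' : S'.ShortExact) (φ : S ⟶ S') :
    liftδ H e S hS ≫ (L.map φ.τ₁)⟦(1 : ℤ)⟧' = L.map φ.τ₃ ≫ liftδ H e S' hS' := by
  apply G.map_injective
  have h₁ := e.inv.naturality φ.τ₁
  have h₂ := e.hom.naturality φ.τ₃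
  have h₃ := H.δ_naturality S S' hS hS' φ
  have h₄ := (G.commShiftIso (1 : ℤ)).inv.naturality (L.map φ.τ₁)
  dsimp at h₁ h₂ h₄
  rw [Functor.map_comp, Functor.map_comp, map_liftδ, map_liftδ, reassoc_of% h₂,
    ← reassoc_of% h₃, ← Functor.map_comp_assoc, h₁]
  simp [h₄]

variable [HasZeroObject T] [Preadditive T] [∀ n : ℤ, (shiftFunctor T n).Additive]

/-- The image of the triangle of a short exact sequence. -/
noncomputable def liftδTriangleIso {X Y Z : A} {i : X ⟶ Y} {p : Y ⟶ Z} {w : i ≫ p = 0}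
    (hS : (ShortComplex.mk i p w).ShortExact) :
    G.mapTriangle.obj (Triangle.mk (L.map i) (L.map p) (liftδ H e _ hS)) ≅
      Triangle.mk (H.functor.map i) (H.functor.map p) (H.δ _ hS) :=
  triangleMkIso (f := G.map (L.map i)) (g := G.map (L.map p))
    (d := G.map (liftδ H e _ hS) ≫ (G.commShiftIso (1 : ℤ)).hom.app _)
    (e.app X) (e.app Y) (e.app Z) (e.hom.naturality i) (e.hom.naturality p)
    (by simp [← Functor.map_comp])

end

variable {H : ExactRealization A V} [HasExt.{w} A] [HasDerivedCategory.{w'} A]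
  {D' E' D E : ObjectProperty A} (h : IsLocalizationContext.{w} D' E' D E)
  (hH : H.IsAdapted D' E' D E) {M : AbelianModelStructure A} (hM : M.IsTriple D E')
  {G : M.Ho ⥤ V} (e : M.Q ⋙ G ≅ H.functor)

include h hH hM e

lemma ExactRealization.IsAdapted.exists_cone [G.Full] [G.Faithful] {X Y : M.Ho} (f : X ⟶ Y) :
    ∃ (Z : M.Ho) (g : G.obj Y ⟶ G.obj Z) (k : G.obj Z ⟶ (G.obj X)⟦(1 : ℤ)⟧),
      Triangle.mk (G.map f) g k ∈ distTriang V := by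
  obtain ⟨X₀, Y₀, Z₀, i, p, w, hS, eX, eY, fac⟩ := hH.exists_arrow_iso h hM f
  refine ⟨M.Q.obj Z₀, G.map eY.hom ≫ e.hom.app Y₀ ≫ H.functor.map p ≫ e.inv.app Z₀,
    e.hom.app Z₀ ≫ H.δ _ hS ≫ (e.inv.app X₀ ≫ G.map eX.inv)⟦(1 : ℤ)⟧',
    isomorphic_distinguished _ (H.distTriang_mk hS) _
      (triangleMkIso (G.mapIso eX ≪≫ e.app X₀) (G.mapIso eY ≪≫ e.app Y₀) (e.app Z₀)
        ?_ ?_ ?_)⟩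
  · have := e.hom.naturality i
    dsimp at this ⊢
    rw [← Functor.map_comp_assoc, fac, Functor.map_comp_assoc, this, Category.assoc]
  · have := e.hom.naturality p
    dsimp at this
    simp [this]
  · simp [← Functor.map_comp]

theorem ExactRealization.IsAdapted.exists_canonicalTriangulation
    [CategoryTheory.IsTriangulated V] :
    ∃ (_ : M.CanonicalTriangulation) (_ : G.CommShift ℤ), G.IsTriangulated := by
  have := hH.full h hM e
  have := hH.faithful h hM e
  obtain ⟨_, ⟨_⟩⟩ := exists_shift_of_fully_faithful G (hH.essImage_shift h e)
  let : Preadditive M.Ho := Preadditive.ofFullyFaithful (.ofFullyFaithful G)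
  have : G.Additive := Functor.FullyFaithful.additive_ofFullyFaithful _
  have : HasZeroObject M.Ho := by
    refine ⟨M.Q.obj 0, ?_⟩
    have h₀ : IsZero (G.obj (M.Q.obj 0)) :=
      IsZero.of_iso (H.functor.map_isZero (isZero_zero A)) (e.app 0)
    rw [IsZero.iff_id_eq_zero] at h₀ ⊢
    exact G.map_injective (by rw [G.map_id, h₀, G.map_zero])
  have (n : ℤ) : (shiftFunctor M.Ho n).Additive := by
    have := Functor.additive_of_iso (G.commShiftIso n).symm
    exact Functor.additive_of_comp_faithful _ G
  let := pretriangulatedOfFullyFaithful G (fun X Y f => hH.exists_cone h hM e f)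
  have : G.IsTriangulated := ⟨fun _ hT => hT⟩
  have hdist {X Y Z : A} {i : X ⟶ Y} {p : Y ⟶ Z} {w : i ≫ p = 0}
      (hS : (ShortComplex.mk i p w).ShortExact) :
      Triangle.mk (M.Q.map i) (M.Q.map p) (liftδ H e _ hS) ∈ distTriang M.Ho :=
    isomorphic_distinguished _ (H.distTriang_mk hS) _ (liftδTriangleIso H e hS)
  refine ⟨{
    preadditive := inferInstance
    hasZeroObject := inferInstance
    hasShift := inferInstance
    additive := inferInstance
    pretriangulated := inferInstance
    isTriangulated := IsTriangulated.of_fully_faithful_triangulated_functor G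
    δ := liftδ H e
    δ_naturality := liftδ_naturality H e
    distinguished_iff T := ⟨fun hT => ?_, ?_⟩ }, inferInstance, inferInstance⟩
  -- A distinguished triangle is determined up to isomorphism by its first arrow, and every arrow is
  -- isomorphic to the image of a monomorphism of `A`.
  · obtain ⟨X₀, Y₀, Z₀, i, p, w, hS, eX, eY, fac⟩ := hH.exists_arrow_iso h hM T.mor₁
    exact ⟨_, hS, ⟨isoTriangleOfIso₁₂ _ _ hT (hdist hS) eX eY fac⟩⟩
  · rintro ⟨S, hS, ⟨e'⟩⟩
    exact isomorphic_distinguished _ (hdist hS) _ e'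

end CanonicalTriangulation

/-! ### Fully faithful adjoints from bijectivity on morphisms -/

section Adjoints

variable {H₁ H₂ : Type*} [Category* H₁] [Category* H₂]

lemma isIso_unit_app_of_bijective {F : H₁ ⥤ H₂} {J : H₂ ⥤ H₁} (adj : F ⊣ J) {Y : H₁}
    (hY : ∀ X : H₁, Function.Bijective (F.map : (X ⟶ Y) → _)) : IsIso (adj.unit.app Y) := by
  refine isIso_of_yoneda_map_bijective _ fun X => ?_
  have : (fun g : X ⟶ Y => g ≫ adj.unit.app Y) =
      adj.homEquiv X (F.obj Y) ∘ (F.map : (X ⟶ Y) → _) := by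
    funext g
    simp [Adjunction.homEquiv_unit]
  exact this ▸ (adj.homEquiv X (F.obj Y)).bijective.comp (hY X)

lemma isIso_counit_app_of_bijective {I : H₁ ⥤ H₂} {R : H₂ ⥤ H₁} (adj : I ⊣ R) {X : H₂}
    (hX : ∀ Y : H₂, Function.Bijective (R.map : (X ⟶ Y) → _)) : IsIso (adj.counit.app X) := by
  refine isIso_of_coyoneda_map_bijective _ fun Y => ?_
  have : (fun g : X ⟶ Y => adj.counit.app X ≫ g) =
      (adj.homEquiv (R.obj X) Y).symm ∘ (R.map : (X ⟶ Y) → _) := by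
    funext g
    simp [Adjunction.homEquiv_counit]
  exact this ▸ (adj.homEquiv (R.obj X) Y).symm.bijective.comp (hX Y)

/-- A functor `F` has a fully faithful right adjoint if the codomain is covered by the images of
the objects `Y` such that `F` is bijective on morphisms into `Y`. -/
theorem exists_fully_faithful_rightAdjoint (F : H₁ ⥤ H₂)
    (hF : ∀ Y : H₂, ∃ Y' : H₁, Nonempty (F.obj Y' ≅ Y) ∧
      ∀ X : H₁, Function.Bijective (F.map : (X ⟶ Y') → _)) :
    ∃ (J : H₂ ⥤ H₁) (adj : F ⊣ J), J.Full ∧ J.Faithful ∧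
      ∀ Y' : H₁, (∀ X : H₁, Function.Bijective (F.map : (X ⟶ Y') → _)) →
        IsIso (adj.unit.app Y') := by
  choose J ε hJ using hF
  replace ε Y := (ε Y).some
  let e (X : H₁) (Y : H₂) : (F.obj X ⟶ Y) ≃ (X ⟶ J Y) :=
    ((Equiv.ofBijective _ (hJ Y X)).trans ((ε Y).homToEquiv)).symm
  have he' (X : H₁) (Y : H₂) (g : X ⟶ J Y) : (e X Y).symm g = F.map g ≫ (ε Y).hom := rfl
  have he : ∀ X' X Y f g, e X' Y (F.map f ≫ g) = f ≫ e X Y g := fun X' X Y f g => by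
    rw [← Equiv.eq_symm_apply, he', F.map_comp, Category.assoc, ← he', Equiv.symm_apply_apply]
  -- By construction the counit at `Y` is the chosen isomorphism `ε Y`; this is why the adjoint is
  -- fully faithful.
  let adj := Adjunction.adjunctionOfEquivRight e he
  have hadj (Y : H₂) : adj.counit.app Y = (ε Y).hom := by
    have : adj.counit.app Y = (e (J Y) Y).symm (𝟙 _) := by simp [adj]
    rw [this, he', F.map_id, Category.id_comp]
  have : ∀ Y, IsIso (adj.counit.app Y) := fun Y => by rw [hadj]; infer_instance
  have : IsIso adj.counit := NatIso.isIso_of_isIso_app _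
  refine ⟨_, adj, adj.fullyFaithfulROfIsIsoCounit.full, adj.fullyFaithfulROfIsIsoCounit.faithful,
    fun Y' hY' => isIso_unit_app_of_bijective adj hY'⟩

/-- A functor `R` has a fully faithful left adjoint if the codomain is covered by the images of
the objects `X` such that `R` is bijective on morphisms from `X`. -/
theorem exists_fully_faithful_leftAdjoint (R : H₂ ⥤ H₁)
    (hR : ∀ X : H₁, ∃ X' : H₂, Nonempty (R.obj X' ≅ X) ∧
      ∀ Y : H₂, Function.Bijective (R.map : (X' ⟶ Y) → _)) :
    ∃ (I : H₁ ⥤ H₂) (adj : I ⊣ R), I.Full ∧ I.Faithful ∧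
      ∀ X' : H₂, (∀ Y : H₂, Function.Bijective (R.map : (X' ⟶ Y) → _)) →
        IsIso (adj.counit.app X') := by
  choose I ε hI using hR
  replace ε X := (ε X).some
  let e (X : H₁) (Y : H₂) : (I X ⟶ Y) ≃ (X ⟶ R.obj Y) :=
    (Equiv.ofBijective _ (hI X Y)).trans ((ε X).homFromEquiv)
  have he' (X : H₁) (Y : H₂) (g : I X ⟶ Y) : e X Y g = (ε X).inv ≫ R.map g := rfl
  have he : ∀ X Y Y' g h, e X Y' (h ≫ g) = e X Y h ≫ R.map g := fun X Y Y' g h => by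
    simp [he']
  let adj := Adjunction.adjunctionOfEquivLeft e he
  have hadj (X : H₁) : adj.unit.app X = (ε X).inv := by
    have : adj.unit.app X = e X (I X) (𝟙 _) := by simp [adj]
    rw [this, he', R.map_id, Category.comp_id]
  have : ∀ X, IsIso (adj.unit.app X) := fun X => by rw [hadj]; infer_instance
  have : IsIso adj.unit := NatIso.isIso_of_isIso_app _
  refine ⟨_, adj, adj.fullyFaithfulLOfIsIsoUnit.full, adj.fullyFaithfulLOfIsIsoUnit.faithful,
    fun X' hX' => isIso_counit_app_of_bijective adj hX'⟩

end Adjoints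

/-! ### Adjoints as derived functors -/

section DerivedAdjoints

variable {C H₁ H₂ : Type*} [Category* C] [Category* H₁] [Category* H₂]
  {L₁ : C ⥤ H₁} {L₂ : C ⥤ H₂} (W₁ W₂ : MorphismProperty C)
  [L₁.IsLocalization W₁] [L₂.IsLocalization W₂] {F : H₁ ⥤ H₂} {J : H₂ ⥤ H₁} (adj : F ⊣ J)

/-- The unit which exhibits the right adjoint of a functor `F` between two localizations of
the same category as a right derived functor of the identity. -/
@[simps]
def rightDerivedUnit (α : L₁ ⋙ F ⟶ 𝟭 C ⋙ L₂) : 𝟭 C ⋙ L₁ ⟶ L₂ ⋙ J where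
  app X := adj.unit.app (L₁.obj X) ≫ J.map (α.app X)
  naturality X Y f := by
    have := α.naturality f
    dsimp at this ⊢
    rw [← adj.unit_naturality_assoc, Category.assoc, ← J.map_comp, ← J.map_comp, this]

/-- The counit which exhibits the left adjoint of a functor `J` between two localizations of
the same category as a left derived functor of the identity. -/
@[simps]
def leftDerivedCounit (β : 𝟭 C ⋙ L₁ ⟶ L₂ ⋙ J) : L₁ ⋙ F ⟶ 𝟭 C ⋙ L₂ where
  app X := F.map (β.app X) ≫ adj.counit.app (L₂.obj X)
  naturality X Y f := by
    have := β.naturality f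
    dsimp at this ⊢
    rw [← F.map_comp_assoc, this, F.map_comp_assoc, Category.assoc, ← adj.counit_naturality]

include W₁ in
-- Since `α` is invertible, transformations `L₁ ⟶ L₂ ⋙ G` are transformations `L₁ ⟶ L₁ ⋙ F ⋙ G`. By
-- the universal property of localization they are transformations `𝟭 ⟶ F ⋙ G`, and by adjunction
-- transformations `J ⟶ G`.
theorem isRightDerivedFunctor_rightAdjoint (α : L₁ ⋙ F ⟶ 𝟭 C ⋙ L₂) [IsIso α] :
    J.IsRightDerivedFunctor (rightDerivedUnit adj α) W₂ where
  isLeftKanExtension := by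
    have := Localization.full_whiskeringLeft L₁ W₁ H₁
    have := Localization.faithful_whiskeringLeft L₁ W₁ H₁
    have key (G : H₂ ⥤ H₁) (β : 𝟭 C ⋙ L₁ ⟶ L₂ ⋙ G) :
        ∃ γ : 𝟭 H₁ ⟶ F ⋙ G, ∀ X, γ.app (L₁.obj X) ≫ G.map (α.app X) = β.app X := by
      obtain ⟨γ, hγ⟩ := ((Functor.whiskeringLeft C H₁ H₁).obj L₁).map_surjective
        (X := 𝟭 H₁) (Y := F ⋙ G) (β ≫ Functor.whiskerRight (inv α) G)
      refine ⟨γ, fun X => ?_⟩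
      have := NatTrans.congr_app hγ X
      dsimp at this
      rw [this, Category.assoc, ← G.map_comp, ← NatTrans.comp_app]
      simp
    choose γ hγ using key
    let desc (G : H₂ ⥤ H₁) (β : 𝟭 C ⋙ L₁ ⟶ L₂ ⋙ G) : J ⟶ G :=
      { app Y := (γ G β).app (J.obj Y) ≫ G.map (adj.counit.app Y)
        naturality Y Z f := by
          have := (γ G β).naturality (J.map f)
          dsimp at this ⊢
          rw [reassoc_of% this, Category.assoc, ← G.map_comp, ← G.map_comp,
            adj.counit_naturality] }
    have fac (G : H₂ ⥤ H₁) (β : 𝟭 C ⋙ L₁ ⟶ L₂ ⋙ G) (X : C) :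
        (adj.unit.app (L₁.obj X) ≫ J.map (α.app X)) ≫ (desc G β).app (L₂.obj X) = β.app X := by
      have h₁ := (desc G β).naturality (α.app X)
      have h₂ := (γ G β).naturality (adj.unit.app (L₁.obj X))
      dsimp [desc] at h₁ h₂ ⊢
      rw [Category.assoc, h₁, Category.assoc, reassoc_of% h₂, ← G.map_comp_assoc]
      simp [hγ]
    have uniq (G : H₂ ⥤ H₁) (β : 𝟭 C ⋙ L₁ ⟶ L₂ ⋙ G) (m : J ⟶ G)
        (hm : ∀ X, (adj.unit.app (L₁.obj X) ≫ J.map (α.app X)) ≫ m.app (L₂.obj X) = β.app X) :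
        m = desc G β := by
      let γ' : 𝟭 H₁ ⟶ F ⋙ G := adj.unit ≫ Functor.whiskerLeft F m
      have hγ' : γ' = γ G β := by
        apply Functor.map_injective ((Functor.whiskeringLeft C H₁ H₁).obj L₁)
        ext X
        refine (cancel_mono (G.map (α.app X))).1 (Eq.trans ?_ (hγ G β X).symm)
        have := m.naturality (α.app X)
        dsimp [γ'] at this ⊢
        rw [← hm, Category.assoc, Category.assoc, this]
      ext Y
      have h₁ := NatTrans.congr_app hγ' (J.obj Y)
      have h₂ := m.naturality (adj.counit.app Y)
      dsimp [γ', desc] at h₁ h₂ ⊢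
      rw [← h₁, Category.assoc, ← h₂, adj.right_triangle_components_assoc]
    refine ⟨⟨IsInitial.ofUniqueHom (fun G => StructuredArrow.homMk (desc G.right G.hom) ?_)
      fun G m => ?_⟩⟩
    · ext X
      exact fac _ _ X
    · ext1
      exact uniq _ _ _ fun X => NatTrans.congr_app (StructuredArrow.w m) X

include W₂ in
theorem isLeftDerivedFunctor_leftAdjoint (β : 𝟭 C ⋙ L₁ ⟶ L₂ ⋙ J) [IsIso β] :
    F.IsLeftDerivedFunctor (leftDerivedCounit adj β) W₁ where
  isRightKanExtension := by
    have := Localization.full_whiskeringLeft L₂ W₂ H₂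
    have := Localization.faithful_whiskeringLeft L₂ W₂ H₂
    have key (G : H₁ ⥤ H₂) (α : L₁ ⋙ G ⟶ 𝟭 C ⋙ L₂) :
        ∃ γ : J ⋙ G ⟶ 𝟭 H₂, ∀ X, G.map (β.app X) ≫ γ.app (L₂.obj X) = α.app X := by
      obtain ⟨γ, hγ⟩ := ((Functor.whiskeringLeft C H₂ H₂).obj L₂).map_surjective
        (X := J ⋙ G) (Y := 𝟭 H₂) (Functor.whiskerRight (inv β) G ≫ α)
      refine ⟨γ, fun X => ?_⟩
      have := NatTrans.congr_app hγ X
      dsimp at this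
      rw [this, ← G.map_comp_assoc, ← NatTrans.comp_app]
      simp
    choose γ hγ using key
    let lift (G : H₁ ⥤ H₂) (α : L₁ ⋙ G ⟶ 𝟭 C ⋙ L₂) : G ⟶ F :=
      { app X := G.map (adj.unit.app X) ≫ (γ G α).app (F.obj X)
        naturality X Y f := by
          have := (γ G α).naturality (F.map f)
          dsimp at this ⊢
          rw [Category.assoc, ← this, ← G.map_comp_assoc, ← G.map_comp_assoc,
            adj.unit_naturality] }
    have fac (G : H₁ ⥤ H₂) (α : L₁ ⋙ G ⟶ 𝟭 C ⋙ L₂) (X : C) :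
        (lift G α).app (L₁.obj X) ≫ F.map (β.app X) ≫ adj.counit.app (L₂.obj X) = α.app X := by
      have h₁ := (lift G α).naturality (β.app X)
      have h₂ := (γ G α).naturality (adj.counit.app (L₂.obj X))
      dsimp [lift] at h₁ h₂ ⊢
      rw [← Category.assoc, ← h₁, Category.assoc, Category.assoc, ← h₂,
        ← G.map_comp_assoc (adj.unit.app _), adj.right_triangle_components]
      simp [hγ]
    have uniq (G : H₁ ⥤ H₂) (α : L₁ ⋙ G ⟶ 𝟭 C ⋙ L₂) (m : G ⟶ F)
        (hm : ∀ X, m.app (L₁.obj X) ≫ F.map (β.app X) ≫ adj.counit.app (L₂.obj X) = α.app X) :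
        m = lift G α := by
      let γ' : J ⋙ G ⟶ 𝟭 H₂ := Functor.whiskerLeft J m ≫ adj.counit
      have hγ' : γ' = γ G α := by
        apply Functor.map_injective ((Functor.whiskeringLeft C H₂ H₂).obj L₂)
        ext X
        refine (cancel_epi (G.map (β.app X))).1 (Eq.trans ?_ (hγ G α X).symm)
        have := m.naturality (β.app X)
        dsimp [γ'] at this ⊢
        rw [← hm, reassoc_of% this]
      ext Y
      have h₁ := NatTrans.congr_app hγ' (F.obj Y)
      have h₂ := m.naturality (adj.unit.app Y)
      dsimp [γ', lift] at h₁ h₂ ⊢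
      rw [← h₁, reassoc_of% h₂]
      simp
    refine ⟨⟨IsTerminal.ofUniqueHom (fun G => CostructuredArrow.homMk (lift G.left G.hom) ?_)
      fun G m => ?_⟩⟩
    · ext X
      exact fac _ _ X
    · ext1
      exact uniq _ _ _ fun X => NatTrans.congr_app (CostructuredArrow.w m) X

end DerivedAdjoints

section Triangulated

variable {S S' U U' : Type*} [Category* S] [Category* S'] [Category* U] [Category* U']
  [HasZeroObject S] [HasZeroObject S'] [HasZeroObject U] [HasZeroObject U']
  [Preadditive S] [Preadditive S'] [Preadditive U] [Preadditive U']
  [HasShift S ℤ] [HasShift S' ℤ] [HasShift U ℤ] [HasShift U' ℤ]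
  [∀ n : ℤ, (shiftFunctor S n).Additive] [∀ n : ℤ, (shiftFunctor S' n).Additive]
  [∀ n : ℤ, (shiftFunctor U n).Additive] [∀ n : ℤ, (shiftFunctor U' n).Additive]
  [Pretriangulated S] [Pretriangulated S'] [Pretriangulated U] [Pretriangulated U']

/-- Full faithfulness of `G'` lifts the shift compatibility of `G ⋙ K` to `F`, and exactness of `F`
is detected after composing with `G'`. -/
lemma exists_commShift_isTriangulated {F : S ⥤ S'} {G : S ⥤ U} {G' : S' ⥤ U'} {K : U ⥤ U'}
    (e : F ⋙ G' ≅ G ⋙ K) [G.CommShift ℤ] [G'.CommShift ℤ] [K.CommShift ℤ] [G.IsTriangulated]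
    [G'.IsTriangulated] [K.IsTriangulated] [G'.Full] [G'.Faithful] :
    ∃ _ : F.CommShift ℤ, F.IsTriangulated := by
  let := Functor.CommShift.ofComp (A := ℤ) e
  have := Functor.CommShift.ofComp_compatibility (A := ℤ) e
  exact ⟨inferInstance, (Functor.isTriangulated_iff_comp_right e).2 inferInstance⟩

end Triangulated

/-! ### Functors between the Verdier quotients -/

section Verdier

variable {A : Type u} [Category.{v} A] [Abelian A] [HasDerivedCategory.{w'} A]

lemma exists_verdierQuotient_functor {Cw Fw Cw' Fw' : ObjectProperty A} (h : Cw ≤ Cw')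
    (h' : Fw ≤ Fw') :
    ∃ (K : VerdierQuotient Cw Fw ⥤ VerdierQuotient Cw' Fw') (_ : K.CommShift ℤ),
      K.IsTriangulated ∧
        Nonempty ((verdierRealization Cw Fw).functor ⋙ K ≅ (verdierRealization Cw' Fw').functor) := by
  let P := trivialHull (DerivedCategory.singleFunctor A 0) Cw Fw
  have hP : P.trW.IsInvertedBy (verdierQ Cw' Fw') := fun X Y f hf =>
    Localization.inverts (verdierQ Cw' Fw') _ f
      (ObjectProperty.trW_monotone (trivialHull_monotone h h') _ hf)
  let K : VerdierQuotient Cw Fw ⥤ VerdierQuotient Cw' Fw' :=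
    Localization.lift (verdierQ Cw' Fw') hP (verdierQ Cw Fw)
  let e : verdierQ Cw Fw ⋙ K ≅ verdierQ Cw' Fw' := Localization.fac _ hP _
  let : Localization.Lifting (verdierQ Cw Fw) P.trW (verdierQ Cw' Fw') K := ⟨e⟩
  let := Functor.commShiftOfLocalization (verdierQ Cw Fw) P.trW ℤ (verdierQ Cw' Fw') K
  have : NatTrans.CommShift e.hom ℤ :=
    NatTrans.commShift_iso_hom_of_localization (verdierQ Cw Fw) P.trW ℤ (verdierQ Cw' Fw') K
  have : (verdierQ Cw Fw).mapArrow.EssSurj := Localization.essSurj_mapArrow _ P.trW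
  exact ⟨K, inferInstance, Functor.isTriangulated_of_precomp_iso e,
    ⟨Functor.isoWhiskerLeft (DerivedCategory.singleFunctor A 0) e⟩⟩

lemma inverted_verdierRealization_le {Cw Fw Cw' Fw' : ObjectProperty A} (h : Cw ≤ Cw')
    (h' : Fw ≤ Fw') :
    (verdierRealization Cw Fw).inverted ≤ (verdierRealization Cw' Fw').inverted := by
  intro X Y f (hf : IsIso _)
  obtain ⟨K, _, _, ⟨e⟩⟩ := exists_verdierQuotient_functor h h'
  exact (NatIso.isIso_map_iff e f).1 (inferInstanceAs (IsIso (K.map _)))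

end Verdier

/-! ### The derived identity adjunctions -/

section DerivedAdjunctions

variable {A : Type u} [Category.{v} A] [Abelian A]

lemma bijective_map_Q {M N : AbelianModelStructure A} {T : M.Ho ⥤ N.Ho} (t : M.Q ⋙ T ≅ N.Q)
    {X Y : A} (h₁ : ∀ φ : M.Q.obj X ⟶ M.Q.obj Y, ∃ f, M.Q.map f = φ)
    (h₂ : ∀ φ : N.Q.obj X ⟶ N.Q.obj Y, ∃ f, N.Q.map f = φ)
    (h₃ : ∀ f g : X ⟶ Y, N.Q.map f = N.Q.map g → M.Q.map f = M.Q.map g) :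
    Function.Bijective (T.map : (M.Q.obj X ⟶ M.Q.obj Y) → _) := by
  constructor
  · intro φ ψ h
    obtain ⟨f, rfl⟩ := h₁ φ
    obtain ⟨g, rfl⟩ := h₁ ψ
    refine h₃ _ _ ((cancel_epi (t.hom.app X)).1 ?_)
    have hf := t.hom.naturality f
    have hg := t.hom.naturality g
    dsimp at hf hg
    rw [← hf, ← hg, h]
  · intro φ
    obtain ⟨f, hf⟩ := h₂ (t.inv.app X ≫ φ ≫ t.hom.app Y)
    refine ⟨M.Q.map f, ?_⟩
    have := t.hom.naturality f
    dsimp at this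
    rw [← cancel_mono (t.hom.app Y), this, hf]
    simp

lemma bijective_map_of_iso {H₁ H₂ : Type*} [Category* H₁] [Category* H₂] (T : H₁ ⥤ H₂)
    {X X' Y Y' : H₁} (a : X ≅ X') (b : Y ≅ Y') (h : Function.Bijective (T.map : (X ⟶ Y) → _)) :
    Function.Bijective (T.map : (X' ⟶ Y') → _) := by
  have : (T.map : (X' ⟶ Y') → _) =
      ((T.mapIso a).homCongr (T.mapIso b)) ∘ (T.map : (X ⟶ Y) → _) ∘ (a.homCongr b).symm := by
    funext f
    simp [Iso.homCongr, ← Functor.map_comp]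
  rw [this]
  exact (Equiv.bijective _).comp (h.comp (Equiv.bijective _))

variable {V : Type*} [Category* V]
    [HasZeroObject V] [HasShift V ℤ] [Preadditive V] [∀ n : ℤ, (shiftFunctor V n).Additive]
    [Pretriangulated V] {H : ExactRealization A V} {V' : Type*} [Category* V']
    [HasZeroObject V'] [HasShift V' ℤ] [Preadditive V'] [∀ n : ℤ, (shiftFunctor V' n).Additive]
    [Pretriangulated V'] {H' : ExactRealization A V'}
    [HasExt.{w} A] [HasDerivedCategory.{w'} A]
    {D'' E'' D' E' D E : ObjectProperty A} {M N : AbelianModelStructure A}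

lemma ExactRealization.IsAdapted.map_eq_of_Q_map_eq (h : IsLocalizationContext.{w} D' E' D E)
    (hH : H.IsAdapted D' E' D E) (hM : M.IsTriple D E') {X Y : A} {f g : X ⟶ Y}
    (hfg : M.Q.map f = M.Q.map g) : H.functor.map f = H.functor.map g := by
  let e := Localization.fac H.functor (hH.inverts h hM) M.Q
  have hf := e.hom.naturality f
  have hg := e.hom.naturality g
  rw [Functor.comp_map] at hf hg
  rw [hfg, hg] at hf
  exact ((cancel_epi _).1 hf).symm

namespace AbelianModelStructure

/-- The derived identity adjunction between `(D, ?, E'')` and `(D, ?, E')`. -/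
theorem exists_derivedIdentityAdjunction_right
    (α : IsLocalizationContext.{w} D'' E'' D' E') (β : IsLocalizationContext.{w} D' E' D E)
    (hH : H.IsAdapted D'' E'' D E) (hH' : H'.IsAdapted D' E' D E)
    (hM : M.IsTriple D E'') (hN : N.IsTriple D E') (hW : M.W ≤ N.W) :
    ∃ Ψ : M.DerivedIdentityAdjunction N, Nonempty (M.Q ⋙ Ψ.left ≅ N.Q) ∧
      Ψ.right.Full ∧ Ψ.right.Faithful ∧
      ∀ X, Ψ.right.essImage X ↔ ∃ Y, E' Y ∧ Nonempty (M.Q.obj Y ≅ X) := by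
  have hQ : M.W.IsInvertedBy N.Q := fun _ _ f hf => Localization.inverts N.Q N.W f (hW _ hf)
  let L : M.Ho ⥤ N.Ho := Localization.lift N.Q hQ M.Q
  let l : M.Q ⋙ L ≅ N.Q := Localization.fac _ hQ _
  have hL {Y : A} (hY : E' Y) (X : M.Ho) :
      Function.Bijective (L.map : (X ⟶ M.Q.obj Y) → _) := by
    obtain ⟨X₀, hX₀, ⟨a⟩⟩ := hH.exists_iso_left (α.comp β) hM X
    refine bijective_map_of_iso L a (Iso.refl _) (bijective_map_Q l
      (hM.map_surjective hX₀ (α.right_le _ hY)) (hN.map_surjective hX₀ hY) fun f g hfg => ?_)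
    have h₀ : H'.functor.map (f - g) = 0 := by
      rw [Functor.map_sub, hH'.map_eq_of_Q_map_eq β hN hfg, sub_self]
    -- Here the equality of cores enters: `C` is in `D' ∩ E'`, hence in `D''`, so `f` and `g` are
    -- already equal in the homotopy category of `M`.
    obtain ⟨C, b, c, hC, hC', hbc⟩ := hH'.exists_fac hX₀ hY _ h₀
    exact hH.Q_map_eq_of_sub_eq (α.comp β) hM (α.left_of_core hC hC')
      (a := b) (b := c) (by rw [hbc, add_sub_cancel])
  obtain ⟨J, adj, _, _, hJ⟩ := exists_fully_faithful_rightAdjoint L fun Y => by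
    obtain ⟨Y₀, hY₀, ⟨b⟩⟩ := hH'.exists_iso_right β hN Y
    exact ⟨M.Q.obj Y₀, ⟨l.app Y₀ ≪≫ b⟩, hL hY₀⟩
  let c : M.Q ⋙ L ≅ 𝟭 A ⋙ N.Q := l ≪≫ (Functor.leftUnitor _).symm
  refine ⟨{
    left := L
    leftCounit := c.hom
    isLeftDerived := Functor.isLeftDerivedFunctor_of_inverts M.W L c
    right := J
    rightUnit := rightDerivedUnit adj c.hom
    isRightDerived := isRightDerivedFunctor_rightAdjoint M.W N.W adj c.hom
    adj := adj
    unit_fac := fun X => rfl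
    counit_fac := fun X => by simp }, ⟨l⟩, inferInstance, inferInstance, fun X => ⟨?_, ?_⟩⟩
  · rintro ⟨Y, ⟨a⟩⟩
    obtain ⟨Y₀, hY₀, ⟨b⟩⟩ := hH'.exists_iso_right β hN Y
    have := hJ _ (hL hY₀)
    exact ⟨Y₀, hY₀, ⟨asIso (adj.unit.app (M.Q.obj Y₀)) ≪≫
      J.mapIso (l.app Y₀ ≪≫ b) ≪≫ a⟩⟩
  · rintro ⟨Y, hY, ⟨a⟩⟩
    have := hJ _ (hL hY)
    exact ⟨_, ⟨(asIso (adj.unit.app (M.Q.obj Y))).symm ≪≫ a⟩⟩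

/-- The derived identity adjunction between `(D', ?, E'')` and `(D, ?, E'')`. -/
theorem exists_derivedIdentityAdjunction_left
    (α : IsLocalizationContext.{w} D'' E'' D' E') (β : IsLocalizationContext.{w} D' E' D E)
    (hH : H.IsAdapted D'' E'' D' E') (hH' : H'.IsAdapted D'' E'' D E)
    (hM : M.IsTriple D' E'') (hN : N.IsTriple D E'') (hW : N.W ≤ M.W) :
    ∃ Φ : M.DerivedIdentityAdjunction N, Nonempty (N.Q ⋙ Φ.right ≅ M.Q) ∧
      Φ.left.Full ∧ Φ.left.Faithful ∧
      ∀ X, Φ.left.essImage X ↔ ∃ Y, D' Y ∧ Nonempty (N.Q.obj Y ≅ X) := by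
  have hQ : N.W.IsInvertedBy M.Q := fun _ _ f hf => Localization.inverts M.Q M.W f (hW _ hf)
  let R : N.Ho ⥤ M.Ho := Localization.lift M.Q hQ N.Q
  let r : N.Q ⋙ R ≅ M.Q := Localization.fac _ hQ _
  have hR {X : A} (hX : D' X) (Y : N.Ho) :
      Function.Bijective (R.map : (N.Q.obj X ⟶ Y) → _) := by
    obtain ⟨Y₀, hY₀, ⟨a⟩⟩ := hH'.exists_iso_right (α.comp β) hN Y
    refine bijective_map_of_iso R (Iso.refl _) a (bijective_map_Q r
      (hN.map_surjective (β.le _ hX) hY₀) (hM.map_surjective hX hY₀) fun f g hfg => ?_)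
    have h₀ : H.functor.map (f - g) = 0 := by
      rw [Functor.map_sub, hH.map_eq_of_Q_map_eq α hM hfg, sub_self]
    -- `C` lies in `D''`, the class of trivially cofibrant objects on both sides.
    obtain ⟨C, b, c, hC, hC', hbc⟩ := hH.exists_fac hX hY₀ _ h₀
    exact hH'.Q_map_eq_of_sub_eq (α.comp β) hN hC
      (a := b) (b := c) (by rw [hbc, add_sub_cancel])
  obtain ⟨I, adj, _, _, hI⟩ := exists_fully_faithful_leftAdjoint R fun X => by
    obtain ⟨X₀, hX₀, ⟨b⟩⟩ := hH.exists_iso_left α hM X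
    exact ⟨N.Q.obj X₀, ⟨r.app X₀ ≪≫ b⟩, hR hX₀⟩
  let c : 𝟭 A ⋙ M.Q ≅ N.Q ⋙ R := Functor.leftUnitor _ ≪≫ r.symm
  refine ⟨{
    left := I
    leftCounit := leftDerivedCounit adj c.hom
    isLeftDerived := isLeftDerivedFunctor_leftAdjoint M.W N.W adj c.hom
    right := R
    rightUnit := c.hom
    isRightDerived := Functor.isRightDerivedFunctor_of_inverts N.W R c.symm
    adj := adj
    unit_fac := fun X => by simp
    counit_fac := fun X => rfl }, ⟨r⟩, inferInstance, inferInstance, fun X => ⟨?_, ?_⟩⟩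
  · rintro ⟨Y, ⟨a⟩⟩
    obtain ⟨Y₀, hY₀, ⟨b⟩⟩ := hH.exists_iso_left α hM Y
    have := hI _ (hR hY₀)
    exact ⟨Y₀, hY₀, ⟨(asIso (adj.counit.app (N.Q.obj Y₀))).symm ≪≫
      I.mapIso (r.app Y₀ ≪≫ b) ≪≫ a⟩⟩
  · rintro ⟨Y, hY, ⟨a⟩⟩
    have := hI _ (hR hY)
    exact ⟨_, ⟨asIso (adj.counit.app (N.Q.obj Y)) ≪≫ a⟩⟩

end AbelianModelStructure

end DerivedAdjunctions

lemma isZero_obj_iff {C C' : Type*} [Category* C] [Category* C'] [HasZeroMorphisms C]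
    [HasZeroMorphisms C'] (G : C ⥤ C') [G.Faithful] [G.PreservesZeroMorphisms] {X : C} :
    IsZero (G.obj X) ↔ IsZero X := by
  refine ⟨fun h => ?_, G.map_isZero⟩
  rw [IsZero.iff_id_eq_zero] at h ⊢
  exact G.map_injective (by rw [CategoryTheory.Functor.map_id, h, G.map_zero])

section

variable {A : Type u} [Category.{v} A] [Abelian A] [HasExt.{w} A] [HasDerivedCategory.{w'} A]
  {D' E' D E : ObjectProperty A}

/-- The homotopy category of a localization context, embedded in a Verdier quotient of the
derived category. -/
lemma IsLocalizationContext.exists_canonicalTriangulation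
    (h : IsLocalizationContext.{w} D' E' D E) {M : AbelianModelStructure A}
    (hM : M.IsTriple D E') :
    ∃ (_ : M.CanonicalTriangulation) (G : M.Ho ⥤ VerdierQuotient D' E) (_ : G.CommShift ℤ),
      G.IsTriangulated ∧ G.Full ∧ G.Faithful ∧
        Nonempty (M.Q ⋙ G ≅ (verdierRealization D' E).functor) ∧
        (∀ X, D X → (IsZero (M.Q.obj X) ↔ D' X)) ∧ ∀ X, E' X → (IsZero (M.Q.obj X) ↔ E X) := by
  have hH := h.isAdapted_verdierRealization
  let e := Localization.fac _ (hH.inverts h hM) M.Q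
  obtain ⟨T, c, t⟩ := hH.exists_canonicalTriangulation h hM e
  have := hH.full h hM e
  have := hH.faithful h hM e
  have h₀ (X : A) : IsZero (M.Q.obj X) ↔ IsZero ((verdierRealization D' E).functor.obj X) :=
    (isZero_obj_iff _).symm.trans (Iso.isZero_iff (e.app X))
  exact ⟨T, _, c, t, inferInstance, inferInstance, ⟨e⟩,
    fun X hX => (h₀ X).trans (hH.isZero_left_iff hX),
    fun X hX => (h₀ X).trans (hH.isZero_right_iff hX)⟩

end

end LocSeq

/-! ### The localization sequence -/

theorem mainTheorem6 {A : Type u} [Category.{v} A] [Abelian A] [HasExt.{w} A]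
    (D'' E'' D' E' D E : ObjectProperty A)
    (α : LocSeq.IsLocalizationContext.{w} D'' E'' D' E')
    (β : LocSeq.IsLocalizationContext.{w} D' E' D E) :
    LocSeq.IsLocalizationContext.{w} D'' E'' D E ∧
    (∃! M : LocSeq.AbelianModelStructure A, M.IsTriple D' E'') ∧
    (∃! M : LocSeq.AbelianModelStructure A, M.IsTriple D E'') ∧
    (∃! M : LocSeq.AbelianModelStructure A, M.IsTriple D E') ∧
    ∀ M₁ M₂ M₃ : LocSeq.AbelianModelStructure A,
      M₁.IsTriple D' E'' → M₂.IsTriple D E'' → M₃.IsTriple D E' →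
      M₁.IsIdentityQuillenAdjunction M₂ ∧
      M₂.IsIdentityQuillenAdjunction M₃ ∧
      ∃ (_ : M₁.CanonicalTriangulation) (_ : M₂.CanonicalTriangulation)
        (_ : M₃.CanonicalTriangulation)
        (Φ : M₁.DerivedIdentityAdjunction M₂) (Ψ : M₂.DerivedIdentityAdjunction M₃),
        LocSeq.IsLocalizationSequence Φ.adj Ψ.adj := by
  let := HasDerivedCategory.standard A
  have γ := α.comp β
  refine ⟨γ, α.existsUnique_abelianModelStructure, γ.existsUnique_abelianModelStructure,
    β.existsUnique_abelianModelStructure, fun M₁ M₂ M₃ h₁ h₂ h₃ =>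
      ⟨LocSeq.AbelianModelStructure.isIdentityQuillenAdjunction h₁ h₂ β.le le_rfl,
        LocSeq.AbelianModelStructure.isIdentityQuillenAdjunction h₂ h₃ le_rfl α.right_le, ?_⟩⟩
  have a₁ := α.isAdapted_verdierRealization
  have a₂ := γ.isAdapted_verdierRealization
  have a₃ := β.isAdapted_verdierRealization
  obtain ⟨Φ, ⟨r⟩, hΦ, hΦ', imΦ⟩ :=
    LocSeq.AbelianModelStructure.exists_derivedIdentityAdjunction_left α β a₁ a₂ h₁ h₂ (by
      rw [α.W_eq a₁ h₁, γ.W_eq a₂ h₂]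
      exact LocSeq.inverted_verdierRealization_le le_rfl β.right_le)
  obtain ⟨Ψ, ⟨l⟩, hΨ, hΨ', imΨ⟩ :=
    LocSeq.AbelianModelStructure.exists_derivedIdentityAdjunction_right α β a₂ a₃ h₂ h₃ (by
      rw [γ.W_eq a₂ h₂, β.W_eq a₃ h₃]
      exact LocSeq.inverted_verdierRealization_le α.le le_rfl)
  obtain ⟨T₁, G₁, _, _, _, _, ⟨e₁⟩, -, z₁⟩ := α.exists_canonicalTriangulation h₁
  obtain ⟨T₂, G₂, _, _, _, _, ⟨e₂⟩, -, -⟩ := γ.exists_canonicalTriangulation h₂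
  obtain ⟨T₃, G₃, _, _, _, _, ⟨e₃⟩, z₃, -⟩ := β.exists_canonicalTriangulation h₃
  have := Localization.full_whiskeringLeft M₂.Q M₂.W
  have := Localization.faithful_whiskeringLeft M₂.Q M₂.W
  refine ⟨T₁, T₂, T₃, Φ, Ψ, ?_, ?_, hΦ, hΦ', hΨ, hΨ', fun X => ?_, fun X => ?_⟩
  · obtain ⟨K, _, _, ⟨k⟩⟩ := LocSeq.exists_verdierQuotient_functor (le_refl D'') β.right_le
    -- Both sides agree on objects and morphisms coming from `A`, and an isomorphism there extends
    -- uniquely to the localization. So `Φ.right` is a restriction of the triangulated functor `K`,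
    -- and its left adjoint is then triangulated too.
    let i : Φ.right ⋙ G₁ ≅ G₂ ⋙ K :=
      ((Functor.whiskeringLeft _ _ _).obj M₂.Q).preimageIso
        (Functor.isoWhiskerRight r G₁ ≪≫ e₁ ≪≫ k.symm ≪≫ (Functor.isoWhiskerRight e₂ K).symm)
    obtain ⟨_, _⟩ := LocSeq.exists_commShift_isTriangulated i
    let := Φ.adj.leftAdjointCommShift ℤ
    have := Φ.adj.commShift_of_rightAdjoint ℤ
    exact ⟨inferInstance, inferInstance, .mk'' _⟩
  · obtain ⟨K, _, _, ⟨k⟩⟩ := LocSeq.exists_verdierQuotient_functor α.le (le_refl E)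
    let i : Ψ.left ⋙ G₃ ≅ G₂ ⋙ K :=
      ((Functor.whiskeringLeft _ _ _).obj M₂.Q).preimageIso
        (Functor.isoWhiskerRight l G₃ ≪≫ e₃ ≪≫ k.symm ≪≫ (Functor.isoWhiskerRight e₂ K).symm)
    obtain ⟨_, _⟩ := LocSeq.exists_commShift_isTriangulated i
    let := Ψ.adj.rightAdjointCommShift ℤ
    have := Ψ.adj.commShift_of_leftAdjoint ℤ
    exact ⟨inferInstance, inferInstance, .mk' _⟩
  · rw [imΦ]
    constructor
    · intro hX
      -- A representative in `D` is needed, since only for such objects does vanishing in the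
      -- homotopy category of `M₃` mean membership in `D'`.
      obtain ⟨X₀, hX₀, ⟨b⟩⟩ := a₂.exists_iso_left γ h₂ X
      exact ⟨X₀, (z₃ _ hX₀).1 (.of_iso hX ((l.app X₀).symm ≪≫ Ψ.left.mapIso b)), ⟨b⟩⟩
    · rintro ⟨Y, hY, ⟨b⟩⟩
      exact .of_iso ((z₃ _ (β.le _ hY)).2 hY) (Ψ.left.mapIso b.symm ≪≫ l.app Y)
  · rw [imΨ]
    constructor
    · intro hX
      -- Dually, a representative in `E''` vanishes in the homotopy category of `M₁` exactly when it
      -- lies in `E'`.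
      obtain ⟨X₀, hX₀, ⟨b⟩⟩ := a₂.exists_iso_right γ h₂ X
      exact ⟨X₀, (z₁ _ hX₀).1 (.of_iso hX ((r.app X₀).symm ≪≫ Φ.right.mapIso b)), ⟨b⟩⟩
    · rintro ⟨Y, hY, ⟨b⟩⟩
      exact .of_iso ((z₁ _ (α.right_le _ hY)).2 hY) (Φ.right.mapIso b.symm ≪≫ r.app Y)
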